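/- Let $\zeta\in\mathbb T$ (the circle group). Let $V$ be a finite-dimensional Hilbert space with orthonormal basis $e_1,\dots,e_n$, let $\pi$ be a representation of $\mathbb T$ on $V$ with $\pi_z(e_i)=z^{d_i}e_i$ for $d_1,\dots,d_n\in\mathbb Z$, and let $\omega=\sum_{i,j}\omega_{ij}\,e_i\otimes e_j\in V\otimes V$ be homogeneous of degree $d\in\mathbb Z$, that is, $(\pi_z\otimes\pi_z)\omega=z^d\omega$ for all $z\in\mathbb T$. Put $\Omega=(\omega_{ij})_{i,j}$ and assume that $\overline{\Omega}\,\Omega=c\cdot\pi_{\zeta^d}$ for some $c\in\mathbb C\setminus\{0\}$, where $\overline{\Omega}$ is the entrywise complex conjugate and $\pi_{\zeta^d}$ is written as a matrix in the basis $e_1,\dots,e_n$. Let $A_o(V,\pi,\omega)$ be the universal unital C$^*$-algebra with generators $u_{ij}$, $1\le i,j\le n$, subject to the relations $$\sum_k u_{ki}^*u_{kj}=\delta_{ij},\qquad \sum_k u_{ik}u_{jk}^*=\delta_{ij},\qquad \zeta^{d_jd_i}\sum_k\omega_{ik}\,u_{jk}=\zeta^{d_j(d-d_j)}\sum_k\omega_{kj}\,u_{ki}^*$$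 for all $i,j$. It carries the continuous $\mathbb T$-action $\beta$ with $\beta_z(u_{ij})=z^{d_j-d_i}u_{ij}$ and the comultiplication, the unital $*$-homomorphism $$\Delta\colon A_o(V,\pi,\omega)\to A_o(V,\pi,\omega)\boxtimes_\zeta A_o(V,\pi,\omega),\qquad \Delta(u_{ik})=\sum_l j_1(u_{il})\,j_2(u_{lk}).$$ Here, for C$^*$-algebras $A$, $B$ with $\mathbb T$-actions, represented faithfully and $\mathbb T$-equivariantly on Hilbert spaces $\mathcal L$, $\mathcal M$ with $\mathbb T$-representations, the braided tensor product $A\boxtimes_\zeta B$ is the C$^*$-algebra on $\mathcal L\otimes\mathcal M$ generated by the operators $j_1(a)=a\otimes1$ and $j_2(b)=\mathfrak B\,(b\otimes 1)\,\mathfrak B^*$ for $a\in A$, $b\in B$, where $\mathfrak B\colon\mathcal M\otimes\mathcal L\to\mathcal L\otimes\mathcal M$ is the unitary with $\mathfrak B(\mu\otimes\lambda)=\zeta^{kl}\,\lambda\otimes\mu$ for homogeneous vectors $\mu$, $\lambda$ of degrees $k$, $l$. For equivariant $*$-homomorphisms $f\colon A\to A'$ and $g\colon B\to B'$, let $f\boxtimes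 g\colon A\boxtimes_\zeta B\to A'\boxtimes_\zeta B'$ be the $*$-homomorphism with $j_1(a)\mapsto j_1(f(a))$ and $j_2(b)\mapsto j_2(g(b))$. Let $s\in\mathbb Z$ and put $$\pi'_z=z^{-s}\pi_z\quad(z\in\mathbb T),\qquad \omega'=\sum_{i,j}\zeta^{-s d_j}\,\omega_{ij}\,e_i\otimes e_j .$$ Then $(V,\pi',\omega')$ satisfies the same conditions, with $d_i$ replaced by $d_i'=d_i-s$ and $d$ replaced by $d'=d-2s$ (so $\omega'$ is $(d-2s)$-homogeneous for $\pi'$ and $\overline{\Omega'}\,\Omega'=c'\,\pi'_{\zeta^{d'}}$ for some $c'\neq0$). Moreover, there is a $\mathbb T$-equivariant Hopf $*$-isomorphism $$\varphi\colon A_o(V,\pi,\omega)\to A_o(V,\pi',\omega'),\qquad \varphi(u_{ij})=u_{ij}\quad\text{for all } i,j,$$ that is, a $*$-isomorphism with $\beta'_z\circ\varphi=\varphi\circ\beta_z$ for all $z\in\mathbb T$ and $\Delta'\circ\varphi=(\varphi\boxtimes\varphi)\circ\Delta$. -/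

import Mathlib

open scoped TensorProduct ENNReal

noncomputable section

namespace BraidedOrth

/-! ### Universal unital ⋆-algebras given by generators and relations -/

/-- The free unital complex ⋆-algebra on a set `X`: the free algebra on the letters
`x = (x, false)` and `x⋆ = (x, true)`. -/
def FreeStar (X : Type*) : Type _ := FreeAlgebra ℂ (X × Bool)

namespace FreeStar

variable {X : Type*}

instance : Ring (FreeStar X) := inferInstanceAs (Ring (FreeAlgebra ℂ (X × Bool)))
instance : Algebra ℂ (FreeStar X) := inferInstanceAs (Algebra ℂ (FreeAlgebra ℂ (X × Bool)))

/-- The letters of the free ⋆-algebra. -/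
def letter (x : X × Bool) : FreeStar X := FreeAlgebra.ι ℂ x

/-- The generators of the free ⋆-algebra. -/
def of (x : X) : FreeStar X := letter (x, false)

/-- The opposite of the free algebra with the conjugate scalar action, the target of the
involution. -/
def ConjOp (X : Type*) : Type _ := (FreeStar X)ᵐᵒᵖ

instance : Ring (ConjOp X) := inferInstanceAs (Ring (FreeStar X)ᵐᵒᵖ)

instance : Algebra ℂ (ConjOp X) :=
  RingHom.toAlgebra' ((algebraMap ℂ (FreeStar X)ᵐᵒᵖ).comp (starRingEnd ℂ))
    fun c x => Algebra.commutes (A := (FreeStar X)ᵐᵒᵖ) (starRingEnd ℂ c) x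

/-- The involution, as a multiplicative map to the opposite algebra. -/
def starHom : FreeStar X →ₐ[ℂ] ConjOp X :=
  FreeAlgebra.lift ℂ fun x : X × Bool =>
    (MulOpposite.op (FreeAlgebra.ι ℂ (x.1, !x.2)) : (FreeAlgebra ℂ (X × Bool))ᵐᵒᵖ)

/-- The involution of the free ⋆-algebra: conjugate linear, antimultiplicative, exchanging
`x` and `x⋆`. -/
def starFun (a : FreeStar X) : FreeStar X := MulOpposite.unop (starHom a : (FreeStar X)ᵐᵒᵖ)

theorem starFun_ι (x : X × Bool) :
    starFun (letter x) = letter (x.1, !x.2) := by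
  unfold starFun starHom letter
  erw [FreeAlgebra.lift_ι_apply]
  rfl

theorem starFun_algebraMap (c : ℂ) :
    starFun (algebraMap ℂ (FreeStar X) c) = algebraMap ℂ (FreeStar X) (starRingEnd ℂ c) := by
  unfold starFun
  erw [starHom.commutes c]
  rfl

theorem starFun_add (a b : FreeStar X) : starFun (a + b) = starFun a + starFun b := by
  unfold starFun
  erw [map_add]
  rfl

theorem starFun_mul (a b : FreeStar X) : starFun (a * b) = starFun b * starFun a := by
  unfold starFun
  erw [map_mul]
  rfl

@[elab_as_elim]
theorem induction {C : FreeStar X → Prop} (h1 : ∀ c, C (algebraMap ℂ (FreeStar X) c))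
    (h2 : ∀ x : X × Bool, C (letter x))
    (h3 : ∀ a b, C a → C b → C (a * b))
    (h4 : ∀ a b, C a → C b → C (a + b)) (a : FreeStar X) : C a :=
  FreeAlgebra.induction ℂ (X × Bool) (motive := C) h1 h2 h3 h4 a

instance : StarRing (FreeStar X) where
  star := starFun
  star_involutive a := by
    induction a using FreeStar.induction with
    | h1 c => rw [starFun_algebraMap, starFun_algebraMap, Complex.conj_conj]
    | h2 x => rw [starFun_ι, starFun_ι, Bool.not_not]
    | h3 a b ha hb => rw [starFun_mul, starFun_mul, ha, hb]
    | h4 a b ha hb => rw [starFun_add, starFun_add, ha, hb]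
  star_mul := starFun_mul
  star_add := starFun_add

instance : StarModule ℂ (FreeStar X) where
  star_smul c a := by
    rw [Algebra.smul_def, Algebra.smul_def, star_mul]
    change _ * starFun _ = _
    rw [starFun_algebraMap, ← Algebra.commutes]
    rfl

/-- Evaluation of ⋆-polynomials at a family of elements of a ⋆-algebra. -/
def eval {B : Type*} [Ring B] [StarRing B] [Algebra ℂ B] [StarModule ℂ B] (u : X → B) :
    FreeStar X →⋆ₐ[ℂ] B where
  __ := (FreeAlgebra.lift ℂ fun x : X × Bool => if x.2 then star (u x.1) else u x.1 :
    FreeAlgebra ℂ (X × Bool) →ₐ[ℂ] B)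
  map_star' a := by
    set f : FreeStar X →ₐ[ℂ] B := (FreeAlgebra.lift ℂ
      fun x : X × Bool => if x.2 then star (u x.1) else u x.1) with hf
    change f (star a) = star (f a)
    induction a using FreeStar.induction with
    | h1 c =>
      have : star (algebraMap ℂ (FreeStar X) c) = algebraMap ℂ _ (starRingEnd ℂ c) :=
        starFun_algebraMap c
      rw [this, f.commutes, f.commutes, starRingEnd_apply, algebraMap_star_comm]
    | h2 x =>
      have : star (letter x) = letter (x.1, !x.2) := starFun_ι x
      have h : ∀ y : X × Bool, f (letter y) =
        if y.2 then star (u y.1) else u y.1 := fun y => FreeAlgebra.lift_ι_apply _ _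
      rw [this, h, h]
      rcases x with ⟨x, b⟩
      cases b <;> simp
    | h3 a b ha hb => rw [star_mul, map_mul, map_mul, star_mul, ha, hb]
    | h4 a b ha hb => rw [star_add, map_add, map_add, star_add, ha, hb]

@[simp] theorem eval_of {B : Type*} [Ring B] [StarRing B] [Algebra ℂ B] [StarModule ℂ B]
    (u : X → B) (x : X) : eval u (of x) = u x := by
  have := FreeAlgebra.lift_ι_apply (R := ℂ)
    (fun x : X × Bool => if x.2 then star (u x.1) else u x.1) (x, false)
  exact this.trans (by simp)

theorem star_of (x : X) : star (of x) = letter (x, true) :=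
  starFun_ι (x, false)

end FreeStar

/-- The relation on the free ⋆-algebra that sets the elements of `R` and their adjoints to `0`. -/
def PresRel {X : Type*} (R : Set (FreeStar X)) (a b : FreeStar X) : Prop :=
  (a ∈ R ∨ star a ∈ R) ∧ b = 0

/-- The universal unital ⋆-algebra with generators `X` and relations `r = 0` for `r ∈ R`. -/
def PresentedStar {X : Type*} (R : Set (FreeStar X)) : Type _ := RingQuot (PresRel R)

namespace PresentedStar

variable {X : Type*} (R : Set (FreeStar X))

instance : Ring (PresentedStar R) := inferInstanceAs (Ring (RingQuot (PresRel R)))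
instance : Algebra ℂ (PresentedStar R) := inferInstanceAs (Algebra ℂ (RingQuot (PresRel R)))

/-- The quotient map from the free ⋆-algebra. -/
def mk : FreeStar X →ₐ[ℂ] PresentedStar R := RingQuot.mkAlgHom ℂ (PresRel R)

theorem mk_surjective : Function.Surjective (mk R) := RingQuot.mkAlgHom_surjective ℂ _

variable {R}

theorem mk_eq_zero {a : FreeStar X} (h : a ∈ R ∨ star a ∈ R) : mk R a = 0 := by
  have := RingQuot.mkAlgHom_rel ℂ (s := PresRel R) (x := a) (y := 0) ⟨h, rfl⟩
  exact this.trans (map_zero _)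

variable (R)

/-- The involution of the quotient, as a ring homomorphism to the opposite ring. -/
def starHom : PresentedStar R →+* (PresentedStar R)ᵐᵒᵖ :=
  RingQuot.lift
    ⟨((mk R : FreeStar X →+* PresentedStar R).op).comp
      (starRingEquiv : FreeStar X ≃+* (FreeStar X)ᵐᵒᵖ).toRingHom, by
      rintro a b ⟨h, rfl⟩
      rw [map_zero]
      change MulOpposite.op (mk R (star a)) = 0
      rw [mk_eq_zero (by rw [star_star]; exact h.symm), MulOpposite.op_zero]⟩

theorem starHom_mk (a : FreeStar X) : starHom R (mk R a) = MulOpposite.op (mk R (star a)) := by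
  have h : mk R a = RingQuot.mkRingHom (PresRel R) a := by
    unfold mk
    rw [← RingQuot.mkAlgHom_coe ℂ]
    rfl
  rw [h]
  exact RingQuot.lift_mkRingHom_apply _ _ a

instance : Star (PresentedStar R) := ⟨fun a => (starHom R a).unop⟩

theorem star_mk (a : FreeStar X) : star (mk R a) = mk R (star a) := by
  change (starHom R (mk R a)).unop = _
  rw [starHom_mk, MulOpposite.unop_op]

instance : StarRing (PresentedStar R) where
  star_involutive a := by
    obtain ⟨a, rfl⟩ := mk_surjective R a
    rw [star_mk, star_mk, star_star]
  star_mul a b := by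
    obtain ⟨a, rfl⟩ := mk_surjective R a
    obtain ⟨b, rfl⟩ := mk_surjective R b
    rw [← map_mul, star_mk, star_mk, star_mk, star_mul, map_mul]
  star_add a b := by
    obtain ⟨a, rfl⟩ := mk_surjective R a
    obtain ⟨b, rfl⟩ := mk_surjective R b
    rw [← map_add, star_mk, star_mk, star_mk, star_add, map_add]

instance : StarModule ℂ (PresentedStar R) where
  star_smul c a := by
    obtain ⟨a, rfl⟩ := mk_surjective R a
    rw [← map_smul, star_mk, star_mk, star_smul, map_smul]

/-- The generators of the presented ⋆-algebra. -/
def gen (x : X) : PresentedStar R := mk R (FreeStar.of x)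

/-- The quotient map as a ⋆-homomorphism. -/
def mkStar : FreeStar X →⋆ₐ[ℂ] PresentedStar R where
  __ := mk R
  map_star' a := (star_mk R a).symm

variable {R}

/-- The universal property: families satisfying the relations give ⋆-homomorphisms. -/
def lift {B : Type*} [Ring B] [StarRing B] [Algebra ℂ B] [StarModule ℂ B] (u : X → B)
    (hu : ∀ r ∈ R, FreeStar.eval u r = 0) : PresentedStar R →⋆ₐ[ℂ] B where
  __ := (RingQuot.liftAlgHom ℂ ⟨(FreeStar.eval u).toAlgHom, by
      rintro a b ⟨h, rfl⟩
      rw [map_zero]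
      change FreeStar.eval u a = 0
      rcases h with h | h
      · exact hu a h
      · rw [← star_star a, map_star, hu _ h, star_zero]⟩ : RingQuot (PresRel R) →ₐ[ℂ] B)
  map_star' a := by
    obtain ⟨a, rfl⟩ := mk_surjective R a
    rw [star_mk]
    change RingQuot.liftAlgHom ℂ _ (RingQuot.mkAlgHom ℂ (PresRel R) (star a)) =
      star (RingQuot.liftAlgHom ℂ _ (RingQuot.mkAlgHom ℂ (PresRel R) a))
    rw [RingQuot.liftAlgHom_mkAlgHom_apply, RingQuot.liftAlgHom_mkAlgHom_apply]
    exact map_star (FreeStar.eval u) a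

theorem lift_mk {B : Type*} [Ring B] [StarRing B] [Algebra ℂ B] [StarModule ℂ B] (u : X → B)
    (hu : ∀ r ∈ R, FreeStar.eval u r = 0) (a : FreeStar X) :
    lift u hu (mk R a) = FreeStar.eval u a :=
  RingQuot.liftAlgHom_mkAlgHom_apply ℂ _ _ a

@[simp] theorem lift_gen {B : Type*} [Ring B] [StarRing B] [Algebra ℂ B] [StarModule ℂ B]
    (u : X → B) (hu : ∀ r ∈ R, FreeStar.eval u r = 0) (x : X) : lift u hu (gen R x) = u x := by
  rw [gen, lift_mk, FreeStar.eval_of]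

/-- Induction over the generators. -/
@[elab_as_elim]
theorem induction {C : PresentedStar R → Prop} (h1 : ∀ c, C (algebraMap ℂ _ c))
    (h2 : ∀ x, C (gen R x)) (h2' : ∀ x, C (star (gen R x)))
    (h3 : ∀ a b, C a → C b → C (a * b))
    (h4 : ∀ a b, C a → C b → C (a + b)) (a : PresentedStar R) : C a := by
  obtain ⟨a, rfl⟩ := mk_surjective R a
  induction a using FreeStar.induction with
  | h1 c => rw [AlgHom.commutes]; exact h1 c
  | h2 x =>
    rcases x with ⟨x, b⟩
    cases b
    · exact h2 x
    · have := h2' x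
      rw [gen, star_mk, FreeStar.star_of] at this
      exact this
  | h3 a b ha hb => rw [map_mul]; exact h3 _ _ ha hb
  | h4 a b ha hb => rw [map_add]; exact h4 _ _ ha hb

end PresentedStar

/-! ### The completion of a ⋆-algebra in its largest C⋆-seminorm -/

/-- A C⋆-seminorm on a unital complex ⋆-algebra. -/
structure CStarSeminorm (F : Type*) [Ring F] [StarRing F] [Algebra ℂ F] extends
    RingSeminorm F where
  smul' : ∀ (c : ℂ) (a : F), toFun (c • a) = ‖c‖ * toFun a
  star_mul_self' : ∀ a : F, toFun (star a * a) = toFun a ^ 2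

namespace CStarSeminorm

variable {F : Type*} [Ring F] [StarRing F] [Algebra ℂ F]

instance : CoeFun (CStarSeminorm F) fun _ => F → ℝ := ⟨fun p => p.toRingSeminorm⟩

variable (p : CStarSeminorm F)

theorem smul (c : ℂ) (a : F) : p (c • a) = ‖c‖ * p a := p.smul' c a
theorem star_mul_self (a : F) : p (star a * a) = p a ^ 2 := p.star_mul_self' a
theorem nonneg (a : F) : 0 ≤ p a := apply_nonneg p.toRingSeminorm a
theorem add_le (a b : F) : p (a + b) ≤ p a + p b := map_add_le_add p.toRingSeminorm a b
theorem mul_le (a b : F) : p (a * b) ≤ p a * p b := map_mul_le_mul p.toRingSeminorm a b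

theorem le_star (a : F) : p a ≤ p (star a) := by
  have h1 := p.star_mul_self a
  have h2 := p.mul_le (star a) a
  have h3 := p.nonneg a
  have h4 := p.nonneg (star a)
  by_contra h
  push Not at h
  nlinarith

theorem star_eq (a : F) : p (star a) = p a :=
  le_antisymm (by simpa using p.le_star (star a)) (p.le_star a)

theorem one_le : p 1 ≤ 1 := by
  have h1 := p.star_mul_self 1
  rw [star_one, one_mul] at h1
  have h3 := p.nonneg 1
  by_contra h
  push Not at h
  nlinarith

/-- The C⋆-seminorm induced by a ⋆-homomorphism to a C⋆-algebra. -/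
def comap {B : Type*} [CStarAlgebra B] (f : F →⋆ₐ[ℂ] B) : CStarSeminorm F where
  toFun a := ‖f a‖
  map_zero' := by simp
  add_le' a b := by rw [map_add]; exact norm_add_le _ _
  mul_le' a b := by rw [map_mul]; exact norm_mul_le _ _
  neg' a := by rw [map_neg, norm_neg]
  smul' c a := by rw [map_smul, norm_smul]
  star_mul_self' a := by rw [map_mul, map_star, CStarRing.norm_star_mul_self, sq]

theorem comap_apply {B : Type*} [CStarAlgebra B] (f : F →⋆ₐ[ℂ] B) (a : F) :
    comap f a = ‖f a‖ := rfl

instance : Nonempty (CStarSeminorm F) :=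
  ⟨{ toFun := fun _ => 0
     map_zero' := rfl
     add_le' := by simp
     mul_le' := by simp
     neg' := by simp
     smul' := by simp
     star_mul_self' := by simp }⟩

/-- The largest C⋆-seminorm, on a ⋆-algebra on which C⋆-seminorms are pointwise bounded. -/
def largest (h : ∀ a : F, BddAbove (Set.range fun p : CStarSeminorm F => p a)) :
    CStarSeminorm F where
  toFun a := ⨆ p : CStarSeminorm F, p a
  map_zero' := by
    have : ∀ p : CStarSeminorm F, p 0 = 0 := fun p => map_zero p.toRingSeminorm
    simp [this]
  add_le' a b := ciSup_le fun p => (p.add_le a b).trans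
    (add_le_add (le_ciSup (h a) p) (le_ciSup (h b) p))
  mul_le' a b := ciSup_le fun p => (p.mul_le a b).trans
    (mul_le_mul (le_ciSup (h a) p) (le_ciSup (h b) p) (p.nonneg b)
      ((p.nonneg a).trans (le_ciSup (h a) p)))
  neg' a := by
    have : ∀ p : CStarSeminorm F, p (-a) = p a := fun p => map_neg_eq_map p.toRingSeminorm a
    simp [this]
  smul' c a := by
    simp_rw [smul]
    exact (Real.mul_iSup_of_nonneg (norm_nonneg c) _).symm
  star_mul_self' a := by
    have h0 : 0 ≤ ⨆ p : CStarSeminorm F, p a := Real.iSup_nonneg fun p => p.nonneg a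
    apply le_antisymm
    · exact ciSup_le fun p => by
        rw [star_mul_self]
        exact pow_le_pow_left₀ (p.nonneg a) (le_ciSup (h a) p) 2
    · have h1 : (⨆ p : CStarSeminorm F, p a) ≤ √(⨆ p : CStarSeminorm F, p (star a * a)) :=
        ciSup_le fun p => Real.le_sqrt_of_sq_le <| by
          rw [← star_mul_self]
          exact le_ciSup (h (star a * a)) p
      have h2 : 0 ≤ ⨆ p : CStarSeminorm F, p (star a * a) :=
        Real.iSup_nonneg fun p => p.nonneg _
      calc _ ≤ √(⨆ p : CStarSeminorm F, p (star a * a)) ^ 2 := pow_le_pow_left₀ h0 h1 2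
        _ = _ := Real.sq_sqrt h2

theorem le_largest (h : ∀ a : F, BddAbove (Set.range fun p : CStarSeminorm F => p a)) (a : F) :
    p a ≤ largest h a := le_ciSup (h a) p

/-- The ⋆-algebra `F` regarded as a seminormed space through `p`. -/
@[nolint unusedArguments]
def Pre (_p : CStarSeminorm F) : Type _ := F

instance : SeminormedRing p.Pre := p.toRingSeminorm.toSeminormedRing
instance : StarRing p.Pre := inferInstanceAs (StarRing F)

instance : NormedAlgebra ℂ p.Pre where
  __ := (inferInstanceAs (Algebra ℂ F) : Algebra ℂ F)
  norm_smul_le c a := (p.smul c a).le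

theorem norm_star_pre (a : p.Pre) : ‖star a‖ = ‖a‖ := p.star_eq a

theorem norm_star_mul_pre (a : p.Pre) : ‖star a * a‖ = ‖a‖ * ‖a‖ :=
  (p.star_mul_self a).trans (sq _)

theorem isometry_star_pre : Isometry (star : p.Pre → p.Pre) :=
  AddMonoidHomClass.isometry_of_norm (starAddEquiv : p.Pre ≃+ p.Pre) p.norm_star_pre

/-- The (Hausdorff) completion of a ⋆-algebra in a C⋆-seminorm. -/
def Compl : Type _ := UniformSpace.Completion p.Pre

namespace Compl

open UniformSpace

instance : NormedRing p.Compl := inferInstanceAs (NormedRing (Completion p.Pre))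
instance : CompleteSpace p.Compl := inferInstanceAs (CompleteSpace (Completion p.Pre))
instance : NormedAlgebra ℂ p.Compl where
  __ := (inferInstanceAs (Algebra ℂ (Completion p.Pre)) : Algebra ℂ (Completion p.Pre))
  norm_smul_le c x := norm_smul_le (α := ℂ) (β := Completion p.Pre) c x

/-- The canonical map to the completion. -/
def toCompl : F → p.Compl := fun a => Completion.coe' (α := p.Pre) a

theorem norm_toCompl (a : F) : ‖toCompl p a‖ = p a := Completion.norm_coe (E := p.Pre) a

theorem denseRange_toCompl : DenseRange (toCompl p) := Completion.denseRange_coe (α := p.Pre)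

theorem toCompl_add (a b : F) : toCompl p (a + b) = toCompl p a + toCompl p b :=
  Completion.coe_add (α := p.Pre) a b
theorem toCompl_mul (a b : F) : toCompl p (a * b) = toCompl p a * toCompl p b :=
  Completion.coe_mul (α := p.Pre) a b

theorem toCompl_algebraMap (c : ℂ) :
    toCompl p (algebraMap ℂ F c) = algebraMap ℂ p.Compl c := rfl

theorem induction {C : p.Compl → Prop} (hc : IsClosed {x | C x}) (h : ∀ a, C (toCompl p a))
    (x : p.Compl) : C x := Completion.induction_on (α := p.Pre) x hc h

theorem induction₂ {C : p.Compl → p.Compl → Prop} (hc : IsClosed {x : p.Compl × p.Compl | C x.1 x.2})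
    (h : ∀ a b, C (toCompl p a) (toCompl p b)) (x y : p.Compl) : C x y :=
  Completion.induction_on₂ (α := p.Pre) (β := p.Pre) x y hc h

instance : Star p.Compl := ⟨Completion.map (star : p.Pre → p.Pre)⟩

theorem star_toCompl (a : F) : star (toCompl p a) = toCompl p (star a) :=
  Completion.map_coe p.isometry_star_pre.uniformContinuous a

theorem continuous_star_compl : Continuous (star : p.Compl → p.Compl) :=
  Completion.continuous_map

instance : StarRing p.Compl where
  star_involutive x := by
    induction x using induction with
    | hc => 
      exact isClosed_eq ((continuous_star_compl p).comp (continuous_star_compl p)) continuous_id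
    | h a => rw [star_toCompl, star_toCompl, star_star]
  star_mul x y := by
    have := continuous_star_compl p
    induction x, y using induction₂ with
    | hc => exact isClosed_eq (by fun_prop) (by fun_prop)
    | h a b => rw [← toCompl_mul, star_toCompl, star_toCompl, star_toCompl, star_mul, toCompl_mul]
  star_add x y := by
    have := continuous_star_compl p
    induction x, y using induction₂ with
    | hc => exact isClosed_eq (by fun_prop) (by fun_prop)
    | h a b => rw [← toCompl_add, star_toCompl, star_toCompl, star_toCompl, star_add, toCompl_add]

instance : CStarRing p.Compl where
  norm_mul_self_le x := by
    have := continuous_star_compl p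
    induction x using induction with
    | hc => exact isClosed_le (by fun_prop) (by fun_prop)
    | h a =>
      rw [star_toCompl, ← toCompl_mul, norm_toCompl, norm_toCompl, star_mul_self, sq]

/-- The canonical map to the completion, as a ⋆-homomorphism. -/
def incl : F →⋆ₐ[ℂ] p.Compl where
  toFun := toCompl p
  map_one' := Completion.coe_one (α := p.Pre)
  map_mul' := toCompl_mul p
  map_zero' := Completion.coe_zero (α := p.Pre)
  map_add' := toCompl_add p
  commutes' := toCompl_algebraMap p
  map_star' a := (star_toCompl p a).symm

theorem incl_apply (a : F) : incl p a = toCompl p a := rfl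

theorem norm_incl (a : F) : ‖incl p a‖ = p a := norm_toCompl p a

instance [StarModule ℂ F] : StarModule ℂ p.Compl where
  star_smul c x := by
    have := continuous_star_compl p
    rw [Algebra.smul_def, star_mul, Algebra.smul_def, ← toCompl_algebraMap, star_toCompl,
      ← algebraMap_star_comm, toCompl_algebraMap, Algebra.commutes]

/-- The completion of a unital ⋆-algebra in a C⋆-seminorm is a unital C⋆-algebra. -/
instance [StarModule ℂ F] : CStarAlgebra p.Compl where

variable {p}

/-- A ⋆-homomorphism as a ring homomorphism on the seminormed ring. -/
def preHom {B : Type*} [CStarAlgebra B] (f : F →⋆ₐ[ℂ] B) : p.Pre →+* B := (f : F →+* B)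

theorem continuous_preHom {B : Type*} [CStarAlgebra B] (f : F →⋆ₐ[ℂ] B)
    (hf : ∀ a, ‖f a‖ ≤ p a) : Continuous (preHom (p := p) f) :=
  AddMonoidHomClass.continuous_of_bound (preHom (p := p) f) 1
    fun a => by rw [one_mul]; exact hf a

/-- Extension of a bounded ⋆-homomorphism to the completion. -/
def extend {B : Type*} [CStarAlgebra B] (f : F →⋆ₐ[ℂ] B) (hf : ∀ a, ‖f a‖ ≤ p a) :
    p.Compl →⋆ₐ[ℂ] B :=
  let g : p.Compl →+* B := Completion.extensionHom (α := p.Pre) (preHom f) (continuous_preHom f hf)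
  have hg : ∀ a, g (toCompl p a) = f a := fun a =>
    Completion.extensionHom_coe _ (continuous_preHom f hf) a
  have hgc : Continuous g := Completion.continuous_extension
  { g with
    commutes' := fun c => (hg (algebraMap ℂ F c)).trans (AlgHomClass.commutes f c)
    map_star' := fun x => by
      change g (star x) = star (g x)
      induction x using induction with
      | hc =>
        exact isClosed_eq (hgc.comp (continuous_star_compl p)) (continuous_star.comp hgc)
      | h a => rw [star_toCompl, hg, hg, map_star] }

theorem extend_incl {B : Type*} [CStarAlgebra B] (f : F →⋆ₐ[ℂ] B) (hf : ∀ a, ‖f a‖ ≤ p a)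
    (a : F) : extend f hf (incl p a) = f a :=
  Completion.extensionHom_coe (α := p.Pre) _ (continuous_preHom f hf) a

end Compl

end CStarSeminorm

/-! ### The data `(V, π, ω)` and the C⋆-algebra `A_o(V, π, ω)` -/

theorem continuous_starHom {A B : Type*} [CStarAlgebra A] [CStarAlgebra B] (f : A →⋆ₐ[ℂ] B) :
    Continuous f :=
  AddMonoidHomClass.continuous_of_bound f 1 fun a => by
    rw [one_mul]; exact NonUnitalStarAlgHom.norm_apply_le f a

/-- The coefficient matrix `Ω` of `ω = ∑ i, ∑ j, Ω i j • (e i ⊗ e j)`. -/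
def coeffMatrix {n : ℕ} {V : Type*} [NormedAddCommGroup V] [InnerProductSpace ℂ V]
    (e : OrthonormalBasis (Fin n) ℂ V) (ω : V ⊗[ℂ] V) : Matrix (Fin n) (Fin n) ℂ :=
  Matrix.of fun i j => (e.toBasis.tensorProduct e.toBasis).repr ω (i, j)

/-- The data defining a braided free orthogonal quantum group with twisting parameter `ζ`:
a representation `π` of the circle on `V` that acts on the vector `e i` of the orthonormal basis
`e` by `z ^ deg i`, and a `d`-homogeneous vector `ω ∈ V ⊗ V` whose coefficient matrix `Ω` satisfies
`conj Ω * Ω = c • π (ζ ^ d)` for a non-zero scalar `c`. -/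
structure Datum (ζ : Circle) {n : ℕ} {V : Type*} [NormedAddCommGroup V] [InnerProductSpace ℂ V]
    (e : OrthonormalBasis (Fin n) ℂ V) where
  /-- the representation `π` of the circle on `V` -/
  rep : Representation ℂ Circle V
  /-- the degrees of the basis vectors -/
  deg : Fin n → ℤ
  rep_basis : ∀ (z : Circle) (i : Fin n), rep z (e i) = ((z ^ deg i : Circle) : ℂ) • e i
  /-- the vector `ω` -/
  ω : V ⊗[ℂ] V
  /-- the degree of `ω` -/
  d : ℤ
  homogeneous : ∀ z : Circle,
    TensorProduct.map (rep z) (rep z) ω = ((z ^ d : Circle) : ℂ) • ω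
  condition : ∃ c : ℂ, c ≠ 0 ∧
    (coeffMatrix e ω).map star * coeffMatrix e ω =
      c • LinearMap.toMatrix e.toBasis e.toBasis (rep (ζ ^ d))

namespace Datum

variable {ζ : Circle} {n : ℕ} {V : Type*} [NormedAddCommGroup V] [InnerProductSpace ℂ V]
  {e : OrthonormalBasis (Fin n) ℂ V} (D : Datum ζ e)

/-- The coefficients of `ω = ∑ i, ∑ j, ω i j • (e i ⊗ e j)`. -/
def coeff (i j : Fin n) : ℂ := coeffMatrix e D.ω i j

theorem ω_eq : D.ω = ∑ i, ∑ j, D.coeff i j • (e i ⊗ₜ[ℂ] e j) := by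
  conv_lhs => rw [← (e.toBasis.tensorProduct e.toBasis).sum_repr D.ω]
  rw [Fintype.sum_prod_type]
  simp [coeff, coeffMatrix, Module.Basis.tensorProduct_apply]

theorem eq_zero_of_zpow {m : ℤ} (h : ∀ z : Circle, z ^ m = 1) : m = 0 := by
  by_contra hm
  have h1 := h (Circle.exp (Real.pi / m))
  rw [← Circle.exp_zsmul, zsmul_eq_mul, mul_div_cancel₀ _ (by exact_mod_cast hm)] at h1
  have h2 := congrArg (fun z : Circle => (z : ℂ)) h1
  simp only [Circle.coe_exp, Complex.exp_pi_mul_I, Circle.coe_one] at h2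
  norm_num at h2

/-- A non-zero coefficient `ω i j` forces `deg i + deg j = d`. -/
theorem deg_add_deg {i j : Fin n} (h : D.coeff i j ≠ 0) : D.deg i + D.deg j = D.d := by
  have key : ∀ z : Circle, ((z ^ (D.deg i + D.deg j) : Circle) : ℂ) = (z ^ D.d : Circle) := by
    intro z
    have h1 := congrArg (fun x => (e.toBasis.tensorProduct e.toBasis).repr x (i, j))
      (D.homogeneous z)
    conv at h1 => enter [1]; rw [D.ω_eq]
    simp only [map_sum, map_smul, TensorProduct.map_tmul, D.rep_basis, TensorProduct.smul_tmul,
      TensorProduct.tmul_smul] at h1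
    have h2 : ∀ k l : Fin n, (e.toBasis.tensorProduct e.toBasis).repr (e k ⊗ₜ[ℂ] e l) (i, j) =
        if k = i ∧ l = j then 1 else 0 := by
      intro k l
      have : e k ⊗ₜ[ℂ] e l = (e.toBasis.tensorProduct e.toBasis) (k, l) := by
        simp [Module.Basis.tensorProduct_apply]
      rw [this, Module.Basis.repr_self, Finsupp.single_apply]
      simp
    simp only [Finsupp.coe_finsetSum, Finset.sum_apply, Finsupp.coe_smul, Pi.smul_apply, h2,
      smul_eq_mul] at h1
    rw [Finset.sum_eq_single i, Finset.sum_eq_single j] at h1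
    · simp only [and_self, if_true, mul_one] at h1
      change D.coeff i j * _ = _ * D.coeff i j at h1
      rw [zpow_add, Circle.coe_mul]
      apply mul_left_cancel₀ h
      linear_combination h1
    · intro l _ hl
      simp [hl]
    · simp
    · intro k _ hk
      simp [hk]
    · simp
  have h3 : D.deg i + D.deg j - D.d = 0 := by
    apply eq_zero_of_zpow
    intro z
    have := Circle.coe_injective (key z)
    rw [zpow_sub, this, mul_inv_cancel]
  omega

/-- The relations of `A_o(V, π, ω)` for a matrix `u` over a ⋆-algebra: `u` is unitary and `ω` is
invariant. -/
structure Relations {B : Type*} [Ring B] [StarRing B] [Algebra ℂ B]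
    (u : Fin n → Fin n → B) : Prop where
  isometry : ∀ i j, ∑ k, star (u k i) * u k j = if i = j then 1 else 0
  coisometry : ∀ i j, ∑ k, u i k * star (u j k) = if i = j then 1 else 0
  invariant : ∀ i j,
    ((ζ ^ (D.deg j * D.deg i) : Circle) : ℂ) • ∑ k, D.coeff i k • u j k =
      ((ζ ^ (D.deg j * (D.d - D.deg j)) : Circle) : ℂ) • ∑ k, D.coeff k j • star (u k i)

/-- The generators `u i j` of the free ⋆-algebra. -/
abbrev freeGen (i j : Fin n) : FreeStar (Fin n × Fin n) := FreeStar.of (i, j)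

/-- The relators of `A_o(V, π, ω)`: the differences of both sides of the relations. -/
def relators : Set (FreeStar (Fin n × Fin n)) :=
  (Set.range fun ij : Fin n × Fin n =>
    ∑ k, star (freeGen k ij.1) * freeGen k ij.2 - if ij.1 = ij.2 then 1 else 0) ∪
  (Set.range fun ij : Fin n × Fin n =>
    ∑ k, freeGen ij.1 k * star (freeGen ij.2 k) - if ij.1 = ij.2 then 1 else 0) ∪
  (Set.range fun ij : Fin n × Fin n =>
    ((ζ ^ (D.deg ij.2 * D.deg ij.1) : Circle) : ℂ) • ∑ k, D.coeff ij.1 k • freeGen ij.2 k -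
      ((ζ ^ (D.deg ij.2 * (D.d - D.deg ij.2)) : Circle) : ℂ) •
        ∑ k, D.coeff k ij.2 • star (freeGen k ij.1))

theorem eval_relators_iff {B : Type*} [Ring B] [StarRing B] [Algebra ℂ B] [StarModule ℂ B]
    (f : FreeStar (Fin n × Fin n) →⋆ₐ[ℂ] B) :
    (∀ r ∈ D.relators, f r = 0) ↔ D.Relations fun i j => f (freeGen i j) := by
  have hite : ∀ p : Prop, [Decidable p] →
      f (if p then 1 else 0) = if p then 1 else 0 := by
    intro p _
    split_ifs <;> simp
  constructor
  · intro h
    refine ⟨fun i j => ?_, fun i j => ?_, fun i j => ?_⟩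
    · have := h _ (Or.inl (Or.inl ⟨(i, j), rfl⟩))
      simpa only [map_sub, map_sum, map_mul, map_star, hite, sub_eq_zero] using this
    · have := h _ (Or.inl (Or.inr ⟨(i, j), rfl⟩))
      simpa only [map_sub, map_sum, map_mul, map_star, hite, sub_eq_zero] using this
    · have := h _ (Or.inr ⟨(i, j), rfl⟩)
      simpa only [map_sub, map_sum, map_smul, map_star, sub_eq_zero] using this
  · rintro ⟨h1, h2, h3⟩ r ((⟨⟨i, j⟩, rfl⟩ | ⟨⟨i, j⟩, rfl⟩) | ⟨⟨i, j⟩, rfl⟩)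
    · simpa only [map_sub, map_sum, map_mul, map_star, hite, sub_eq_zero] using h1 i j
    · simpa only [map_sub, map_sum, map_mul, map_star, hite, sub_eq_zero] using h2 i j
    · simpa only [map_sub, map_sum, map_smul, map_star, sub_eq_zero] using h3 i j

/-- The universal unital ⋆-algebra with generators `u i j` subject to the relations. -/
abbrev AlgAo : Type := PresentedStar D.relators

theorem relations_gen : D.Relations fun i j => PresentedStar.gen D.relators (i, j) :=
  (D.eval_relators_iff (PresentedStar.mkStar D.relators)).1
    fun _ hr => PresentedStar.mk_eq_zero (Or.inl hr)

theorem Relations.map {B C : Type*} [Ring B] [StarRing B] [Algebra ℂ B]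
    [Ring C] [StarRing C] [Algebra ℂ C] {u : Fin n → Fin n → B} (hu : D.Relations u)
    (f : B →⋆ₐ[ℂ] C) : D.Relations fun i j => f (u i j) where
  isometry i j := by
    have := congrArg f (hu.isometry i j)
    rw [map_sum] at this
    simp only [map_mul, map_star] at this
    rw [this]
    split_ifs <;> simp
  coisometry i j := by
    have := congrArg f (hu.coisometry i j)
    rw [map_sum] at this
    simp only [map_mul, map_star] at this
    rw [this]
    split_ifs <;> simp
  invariant i j := by
    have := congrArg f (hu.invariant i j)
    simpa only [map_smul, map_sum, map_star] using this

theorem Relations.norm_le {D : Datum ζ e} {B : Type*} [CStarAlgebra B] {u : Fin n → Fin n → B}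
    (hu : D.Relations u) (i j : Fin n) : ‖u i j‖ ≤ 1 := by
  let _ : PartialOrder B := CStarAlgebra.spectralOrder B
  have _ : StarOrderedRing B := CStarAlgebra.spectralOrderedRing B
  have h1 : star (u i j) * u i j ≤ 1 := by
    have h := hu.isometry j j
    rw [if_pos rfl] at h
    rw [← h]
    exact Finset.single_le_sum (f := fun k => star (u k j) * u k j)
      (fun k _ => star_mul_self_nonneg (u k j)) (Finset.mem_univ i)
  have h2 : ‖star (u i j) * u i j‖ ≤ 1 :=
    (CStarAlgebra.norm_le_one_iff_of_nonneg _ (star_mul_self_nonneg _)).2 h1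
  rw [CStarRing.norm_star_mul_self] at h2
  nlinarith [norm_nonneg (u i j)]

theorem bddAbove_cstarSeminorm (a : D.AlgAo) :
    BddAbove (Set.range fun p : CStarSeminorm D.AlgAo => p a) := by
  have hgen : ∀ (p : CStarSeminorm D.AlgAo) (x : Fin n × Fin n),
      p (PresentedStar.gen D.relators x) ≤ 1 := by
    intro p x
    have := ((D.relations_gen).map D (CStarSeminorm.Compl.incl p)).norm_le x.1 x.2
    rwa [CStarSeminorm.Compl.norm_incl] at this
  suffices h : ∃ C : ℝ, ∀ p : CStarSeminorm D.AlgAo, p a ≤ C by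
    obtain ⟨C, hC⟩ := h
    exact ⟨C, by rintro _ ⟨p, rfl⟩; exact hC p⟩
  induction a using PresentedStar.induction with
  | h1 c =>
    refine ⟨‖c‖, fun p => ?_⟩
    rw [Algebra.algebraMap_eq_smul_one, p.smul]
    exact mul_le_of_le_one_right (norm_nonneg c) p.one_le
  | h2 x => exact ⟨1, fun p => hgen p x⟩
  | h2' x => exact ⟨1, fun p => by rw [p.star_eq]; exact hgen p x⟩
  | h3 a b ha hb =>
    obtain ⟨C, hC⟩ := ha
    obtain ⟨C', hC'⟩ := hb
    exact ⟨C * C', fun p => (p.mul_le a b).trans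
      (mul_le_mul (hC p) (hC' p) (p.nonneg b) ((p.nonneg a).trans (hC p)))⟩
  | h4 a b ha hb =>
    obtain ⟨C, hC⟩ := ha
    obtain ⟨C', hC'⟩ := hb
    exact ⟨C + C', fun p => (p.add_le a b).trans (add_le_add (hC p) (hC' p))⟩

/-- The C⋆-algebra `A_o(V, π, ω)`: the completion of the universal unital ⋆-algebra with
generators `u i j` subject to the relations, in its largest C⋆-seminorm. -/
abbrev Ao : Type := (CStarSeminorm.largest D.bddAbove_cstarSeminorm).Compl

/-- The generators `u i j` of `A_o(V, π, ω)`. -/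
def u (i j : Fin n) : D.Ao := CStarSeminorm.Compl.incl _ (PresentedStar.gen D.relators (i, j))

theorem relations_u : D.Relations D.u := (D.relations_gen).map D (CStarSeminorm.Compl.incl _)

/-- The universal property of the C⋆-algebra `A_o(V, π, ω)`. -/
def lift {B : Type*} [CStarAlgebra B] (U : Fin n → Fin n → B) (hU : D.Relations U) :
    D.Ao →⋆ₐ[ℂ] B :=
  CStarSeminorm.Compl.extend
    (PresentedStar.lift (fun x => U x.1 x.2)
      ((D.eval_relators_iff (FreeStar.eval fun x => U x.1 x.2)).2 (by simpa using hU)))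
    fun a => (CStarSeminorm.comap_apply _ a).symm.trans_le
      (CStarSeminorm.le_largest (CStarSeminorm.comap _) D.bddAbove_cstarSeminorm a)

@[simp] theorem lift_u {B : Type*} [CStarAlgebra B] (U : Fin n → Fin n → B)
    (hU : D.Relations U) (i j : Fin n) : D.lift U hU (D.u i j) = U i j := by
  unfold lift u
  rw [CStarSeminorm.Compl.extend_incl, PresentedStar.lift_gen]

/-- A property that is closed and stable under the ⋆-algebra operations holds on `A_o(V, π, ω)` if
it holds on the generators. -/
theorem Ao_induction {C : D.Ao → Prop} (hc : IsClosed {x | C x})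
    (h1 : ∀ c : ℂ, C (algebraMap ℂ _ c)) (h2 : ∀ i j, C (D.u i j)) (h2' : ∀ i j, C (star (D.u i j)))
    (h3 : ∀ a b, C a → C b → C (a * b)) (h4 : ∀ a b, C a → C b → C (a + b)) (a : D.Ao) : C a := by
  refine CStarSeminorm.Compl.induction _ hc (fun a => ?_) a
  rw [← CStarSeminorm.Compl.incl_apply]
  induction a using PresentedStar.induction with
  | h1 c => rw [AlgHomClass.commutes]; exact h1 c
  | h2 x => exact h2 x.1 x.2
  | h2' x => rw [map_star]; exact h2' x.1 x.2
  | h3 a b ha hb => rw [map_mul]; exact h3 _ _ ha hb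
  | h4 a b ha hb => rw [map_add]; exact h4 _ _ ha hb

/-- ⋆-homomorphisms on `A_o(V, π, ω)` are determined by the images of the generators. -/
theorem hom_ext {B : Type*} [CStarAlgebra B] {f g : D.Ao →⋆ₐ[ℂ] B}
    (h : ∀ i j, f (D.u i j) = g (D.u i j)) : f = g := by
  ext a
  have hf : Continuous f := continuous_starHom f
  have hg : Continuous g := continuous_starHom g
  induction a using D.Ao_induction with
  | hc => exact isClosed_eq hf hg
  | h1 c => rw [AlgHomClass.commutes, AlgHomClass.commutes]
  | h2 i j => exact h i j
  | h2' i j => rw [map_star, map_star, h]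
  | h3 a b ha hb => rw [map_mul, map_mul, ha, hb]
  | h4 a b ha hb => rw [map_add, map_add, ha, hb]

end Datum

/-! ### Circle actions, braiding unitaries and the braided tensor product -/

/-- The Hilbert space with orthonormal basis indexed by `S`. -/
abbrev Ell2 (S : Type*) : Type _ := lp (fun _ : S => ℂ) 2

/-- The unitary that maps the basis vector indexed by `s` to `c s` times the basis vector indexed
by `σ s`. -/
def monomialUnitary {S T : Type*} (σ : S ≃ T) (c : S → Circle) : Ell2 S ≃ₗᵢ[ℂ] Ell2 T where
  toFun f := ⟨fun t => (c (σ.symm t) : ℂ) * f (σ.symm t), by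
    have h := (lp.memℓp f).summable (p := 2) (by norm_num)
    refine memℓp_gen ?_
    simpa only [Function.comp_def, norm_mul, Circle.norm_coe, one_mul] using
      (σ.symm.summable_iff).2 h⟩
  invFun f := ⟨fun s => ((c s)⁻¹ : Circle) * f (σ s), by
    have h := (lp.memℓp f).summable (p := 2) (by norm_num)
    refine memℓp_gen ?_
    simpa only [Function.comp_def, norm_mul, Circle.norm_coe, one_mul] using
      (σ.summable_iff).2 h⟩
  map_add' f g := by
    ext t
    simp only [lp.coeFn_add, Pi.add_apply]
    change _ * (f _ + g _) = _ * f _ + _ * g _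
    ring
  map_smul' a f := by
    ext t
    simp only [lp.coeFn_smul, Pi.smul_apply, smul_eq_mul, RingHom.id_apply]
    change _ * (a * f _) = a * (_ * f _)
    ring
  left_inv f := by
    ext s
    simp
  right_inv f := by
    ext t
    simp
  norm_map' f := by
    rw [lp.norm_eq_tsum_rpow (by norm_num), lp.norm_eq_tsum_rpow (by norm_num)]
    congr 1
    simp only [LinearEquiv.coe_mk, LinearMap.coe_mk, AddHom.coe_mk, norm_mul, Circle.norm_coe, one_mul]
    exact σ.symm.tsum_eq fun s => ‖f s‖ ^ (2 : ℝ≥0∞).toReal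

theorem monomialUnitary_apply {S T : Type*} (σ : S ≃ T) (c : S → Circle) (f : Ell2 S) (t : T) :
    monomialUnitary σ c f t = c (σ.symm t) * f (σ.symm t) := rfl

theorem monomialUnitary_symm_apply {S T : Type*} (σ : S ≃ T) (c : S → Circle) (f : Ell2 T)
    (s : S) : (monomialUnitary σ c).symm f s = ((c s)⁻¹ : Circle) * f (σ s) := rfl

/-- The slice `f (·, t)` of a vector in `ℓ²(S × T) = ℓ²(S) ⊗ ℓ²(T)`. -/
def slice {S T : Type*} (f : Ell2 (S × T)) (t : T) : Ell2 S :=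
  ⟨fun s => f (s, t), by
    have h := (lp.memℓp f).summable (p := 2) (by norm_num)
    exact memℓp_gen (h.comp_injective (i := fun s => (s, t))
      (Prod.mk_left_injective t))⟩

theorem slice_apply {S T : Type*} (f : Ell2 (S × T)) (t : T) (s : S) : slice f t s = f (s, t) := rfl

theorem hasSum_slice_inner {S T : Type*} (f g : Ell2 (S × T)) :
    HasSum (fun t => inner ℂ (slice f t) (slice g t)) (inner ℂ f g) := by
  have h := (Equiv.prodComm T S).hasSum_iff.2 (lp.hasSum_inner (𝕜 := ℂ) f g)
  exact h.prod_fiberwise fun t => lp.hasSum_inner (𝕜 := ℂ) (slice f t) (slice g t)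

theorem hasSum_slice_norm {S T : Type*} (f : Ell2 (S × T)) :
    HasSum (fun t => ‖slice f t‖ ^ 2) (‖f‖ ^ 2) := by
  have h := Complex.reCLM.hasSum (hasSum_slice_inner f f)
  simp only [inner_self_eq_norm_sq_to_K] at h
  convert h using 1
  · ext t
    simp [← Complex.ofReal_pow]
  · simp [← Complex.ofReal_pow]

theorem memℓp_of_slices {S T : Type*} (F : T → Ell2 S) (h : Summable fun t => ‖F t‖ ^ 2) :
    Memℓp (fun x : S × T => F x.2 x.1) 2 := by
  refine memℓp_gen ?_
  refine (Equiv.prodComm T S).summable_iff.1 ?_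
  refine (summable_prod_of_nonneg (f := fun x : T × S => ‖F x.1 x.2‖ ^ (2 : ℝ≥0∞).toReal)
    fun _ => Real.rpow_nonneg (norm_nonneg _) _).2 ?_
  have h2 : ∀ t, HasSum (fun s => ‖F t s‖ ^ (2 : ℝ≥0∞).toReal) (‖F t‖ ^ (2 : ℝ≥0∞).toReal) :=
    fun t => lp.hasSum_norm (by norm_num) (F t)
  refine ⟨fun t => (h2 t).summable, ?_⟩
  refine h.congr fun t => ?_
  have := (h2 t).tsum_eq
  simp only [ENNReal.toReal_ofNat, Real.rpow_ofNat] at this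
  simpa using this.symm

/-- The vector with given slices. -/
def ofSlices {S T : Type*} (F : T → Ell2 S) (h : Summable fun t => ‖F t‖ ^ 2) : Ell2 (S × T) :=
  ⟨fun x => F x.2 x.1, memℓp_of_slices F h⟩

theorem summable_slices {S T : Type*} (x : Ell2 S →L[ℂ] Ell2 S) (f : Ell2 (S × T)) :
    Summable fun t => ‖x (slice f t)‖ ^ 2 := by
  refine Summable.of_nonneg_of_le (fun t => by positivity) (fun t => ?_)
    ((hasSum_slice_norm f).summable.mul_left (‖x‖ ^ 2))
  rw [← mul_pow]
  exact pow_le_pow_left₀ (norm_nonneg _) (x.le_opNorm _) 2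

/-- The linear map `x ⊗ 1` on `ℓ²(S × T) = ℓ²(S) ⊗ ℓ²(T)`. -/
def ampLin {S : Type*} (T : Type*) (x : Ell2 S →L[ℂ] Ell2 S) : Ell2 (S × T) →ₗ[ℂ] Ell2 (S × T) where
  toFun f := ofSlices (fun t => x (slice f t)) (summable_slices x f)
  map_add' f g := by
    ext y
    change x (slice (f + g) y.2) y.1 = x (slice f y.2) y.1 + x (slice g y.2) y.1
    have : slice (f + g) y.2 = slice f y.2 + slice g y.2 := rfl
    rw [this, map_add]
    rfl
  map_smul' c f := by
    ext y
    change x (slice (c • f) y.2) y.1 = c * x (slice f y.2) y.1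
    have : slice (c • f) y.2 = c • slice f y.2 := rfl
    rw [this, map_smul]
    rfl

theorem slice_ampLin {S T : Type*} (x : Ell2 S →L[ℂ] Ell2 S) (f : Ell2 (S × T)) (t : T) :
    slice (ampLin T x f) t = x (slice f t) := rfl

theorem norm_ampLin_le {S T : Type*} (x : Ell2 S →L[ℂ] Ell2 S) (f : Ell2 (S × T)) :
    ‖ampLin T x f‖ ≤ ‖x‖ * ‖f‖ := by
  refine (sq_le_sq₀ (norm_nonneg _) (by positivity)).1 ?_
  rw [mul_pow]
  refine hasSum_le (fun t => ?_) (hasSum_slice_norm (ampLin T x f))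
    ((hasSum_slice_norm f).mul_left (‖x‖ ^ 2))
  rw [slice_ampLin, ← mul_pow]
  exact pow_le_pow_left₀ (norm_nonneg _) (x.le_opNorm _) 2

/-- The bounded operator `x ⊗ 1` on `ℓ²(S × T) = ℓ²(S) ⊗ ℓ²(T)`. -/
def ampCLM {S : Type*} (T : Type*) (x : Ell2 S →L[ℂ] Ell2 S) : Ell2 (S × T) →L[ℂ] Ell2 (S × T) :=
  (ampLin T x).mkContinuous ‖x‖ (norm_ampLin_le x)

theorem slice_ampCLM {S T : Type*} (x : Ell2 S →L[ℂ] Ell2 S) (f : Ell2 (S × T)) (t : T) :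
    slice (ampCLM T x f) t = x (slice f t) := rfl

theorem ampCLM_apply {S T : Type*} (x : Ell2 S →L[ℂ] Ell2 S) (f : Ell2 (S × T)) (s : S) (t : T) :
    ampCLM T x f (s, t) = x (slice f t) s := rfl

/-- The unital ⋆-homomorphism `x ↦ x ⊗ 1`. -/
def amp (S T : Type*) : (Ell2 S →L[ℂ] Ell2 S) →⋆ₐ[ℂ] (Ell2 (S × T) →L[ℂ] Ell2 (S × T)) where
  toFun := ampCLM T
  map_one' := rfl
  map_mul' x y := rfl
  map_zero' := rfl
  map_add' x y := rfl
  commutes' c := rfl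
  map_star' x := by
    rw [ContinuousLinearMap.star_eq_adjoint, ContinuousLinearMap.star_eq_adjoint,
      ContinuousLinearMap.eq_adjoint_iff]
    intro f g
    rw [← (hasSum_slice_inner _ _).tsum_eq, ← (hasSum_slice_inner _ _).tsum_eq]
    congr 1
    ext t
    rw [slice_ampCLM, slice_ampCLM, ContinuousLinearMap.adjoint_inner_left]

theorem amp_apply {S T : Type*} (x : Ell2 S →L[ℂ] Ell2 S) (f : Ell2 (S × T)) (s : S) (t : T) :
    amp S T x f (s, t) = x (slice f t) s := rfl

/-- The braiding unitary `ℓ²(S) ⊗ ℓ²(T) → ℓ²(T) ⊗ ℓ²(S)`, which maps the tensor product of the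
basis vectors indexed by `s` and `t`, of degrees `k s` and `l t`, to `ζ ^ (k s * l t)` times the
tensor product in the opposite order. -/
def braiding (ζ : Circle) {S T : Type*} (k : S → ℤ) (l : T → ℤ) : Ell2 (S × T) ≃ₗᵢ[ℂ] Ell2 (T × S) :=
  monomialUnitary (Equiv.prodComm S T) fun x => ζ ^ (k x.1 * l x.2)

/-- The unitary representation of the circle on `ℓ²(S)` for which the basis vector indexed by `s`
has degree `k s`. -/
def circleUnitary {S : Type*} (k : S → ℤ) (z : Circle) : Ell2 S ≃ₗᵢ[ℂ] Ell2 S :=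
  monomialUnitary (Equiv.refl S) fun s => z ^ k s

theorem circleUnitary_apply {S : Type*} (k : S → ℤ) (z : Circle) (f : Ell2 S) (s : S) :
    circleUnitary k z f s = ((z ^ k s : Circle) : ℂ) * f s := rfl

theorem circleUnitary_symm_apply {S : Type*} (k : S → ℤ) (z : Circle) (f : Ell2 S) (s : S) :
    (circleUnitary k z).symm f s = ((z ^ k s)⁻¹ : Circle) * f s := rfl

/-- A continuous action of the circle on a unital C⋆-algebra by ⋆-automorphisms. -/
structure CircleAction (A : Type*) [CStarAlgebra A] where
  toHom : Circle →* (A →⋆ₐ[ℂ] A)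
  continuous_orbit : ∀ a : A, Continuous fun z => toHom z a

/-- Equivariance of a ⋆-homomorphism between C⋆-algebras with circle actions. -/
def Equivariant {A B : Type*} [CStarAlgebra A] [CStarAlgebra B] (α : CircleAction A)
    (β : CircleAction B) (f : A →⋆ₐ[ℂ] B) : Prop :=
  ∀ (z : Circle) (a : A), f (α.toHom z a) = β.toHom z (f a)

/-- A circle-equivariant unital representation of a C⋆-algebra with circle action on a non-zero
Hilbert space with a continuous representation of the circle. The Hilbert space is given through an
orthonormal basis, indexed by `S`, of eigenvectors for the circle representation, that is, the
circle acts on the basis vector indexed by `s` by `z ^ deg s`. -/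
structure CovRep.{u} {A : Type u} [CStarAlgebra A] (α : CircleAction A) where
  S : Type u
  nonempty : Nonempty S
  deg : S → ℤ
  φ : A →⋆ₐ[ℂ] (Ell2 S →L[ℂ] Ell2 S)
  covariant : ∀ (z : Circle) (a : A),
    φ (α.toHom z a) = (circleUnitary deg z).conjStarAlgEquiv (φ a)

/-- The pullback of a covariant representation along an equivariant ⋆-homomorphism. -/
def CovRep.comap.{u} {A A' : Type u} [CStarAlgebra A] [CStarAlgebra A'] {α : CircleAction A}
    {α' : CircleAction A'} (f : A →⋆ₐ[ℂ] A') (hf : Equivariant α α' f) (ρ : CovRep α') :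
    CovRep α where
  S := ρ.S
  nonempty := ρ.nonempty
  deg := ρ.deg
  φ := ρ.φ.comp f
  covariant z a := by
    rw [StarAlgHom.comp_apply, hf, ρ.covariant, StarAlgHom.comp_apply]

/-- The C⋆-algebra of bounded families in a family of unital C⋆-algebras. -/
def BddFam {I : Type*} (A : I → Type*) [∀ i, CStarAlgebra (A i)] [∀ i, Nontrivial (A i)] : Type _ :=
  lp A ∞

namespace BddFam

variable {I : Type*} {A : I → Type*} [∀ i, CStarAlgebra (A i)] [∀ i, Nontrivial (A i)]

/-- Auxiliary instance for `BddFam`. -/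
abbrev instAux : CStarAlgebra (lp A ∞) where

instance : CStarAlgebra (BddFam A) := instAux

/-- The `i`-th component of a bounded family. -/
def component (i : I) : BddFam A →⋆ₐ[ℂ] A i where
  toFun := fun x : lp A ∞ => x i
  map_one' := rfl
  map_mul' _ _ := rfl
  map_zero' := rfl
  map_add' _ _ := rfl
  commutes' _ := rfl
  map_star' _ := rfl

theorem ext {x y : BddFam A} (h : ∀ i, component i x = component i y) : x = y :=
  lp.ext (funext h)

/-- The ⋆-homomorphism to bounded families given by a family of ⋆-homomorphisms. -/
def ofHom {B : Type*} [CStarAlgebra B] (f : ∀ i, B →⋆ₐ[ℂ] A i) : B →⋆ₐ[ℂ] BddFam A where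
  toFun a := (⟨fun i => f i a, memℓp_infty ⟨‖a‖, by
    rintro _ ⟨i, rfl⟩
    exact NonUnitalStarAlgHom.norm_apply_le (f i) a⟩⟩ : lp A ∞)
  map_one' := ext fun i => map_one (f i)
  map_mul' a b := ext fun i => map_mul (f i) a b
  map_zero' := ext fun i => map_zero (f i)
  map_add' a b := ext fun i => map_add (f i) a b
  commutes' c := ext fun i => AlgHomClass.commutes (f i) c
  map_star' a := ext fun i => map_star (f i) a

@[simp] theorem component_ofHom {B : Type*} [CStarAlgebra B] (f : ∀ i, B →⋆ₐ[ℂ] A i) (b : B)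
    (i : I) : component i (ofHom f b) = f i b := rfl

end BddFam

namespace Braided

universe u v

variable {A : Type u} {B : Type v} [CStarAlgebra A] [CStarAlgebra B]
  (ζ : Circle) (α : CircleAction A) (β : CircleAction B)

/-- The operators on the Hilbert space tensor product of a pair of covariant representations. -/
abbrev Ops (i : CovRep α × CovRep β) : Type (max u v) :=
  Ell2 (i.1.S × i.2.S) →L[ℂ] Ell2 (i.1.S × i.2.S)

instance (i : CovRep α × CovRep β) : Nontrivial (Ell2 (i.1.S × i.2.S)) := by
  classical
  have := i.1.nonempty
  have := i.2.nonempty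
  obtain ⟨x⟩ : Nonempty (i.1.S × i.2.S) := inferInstance
  refine ⟨lp.single 2 x (1 : ℂ), 0, fun h => ?_⟩
  have := congrArg (fun f : Ell2 (i.1.S × i.2.S) => f x) h
  simp at this

/-- Bounded families of operators on the Hilbert spaces of all pairs of covariant
representations. -/
def Fam : Type (max (u + 1) (v + 1)) := BddFam fun i : CovRep α × CovRep β => Ops α β i

instance : CStarAlgebra (Fam α β) :=
  inferInstanceAs (CStarAlgebra (BddFam fun i : CovRep α × CovRep β => Ops α β i))

/-- The first leg `a ↦ a ⊗ 1`, in all pairs of covariant representations. -/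
def leg₁ : A →⋆ₐ[ℂ] Fam α β := BddFam.ofHom fun i => (amp i.1.S i.2.S).comp i.1.φ

/-- The second leg: `b ↦ 𝔅 (b ⊗ 1) 𝔅⋆` with the braiding unitary `𝔅`, in all pairs of covariant
representations. -/
def leg₂ : B →⋆ₐ[ℂ] Fam α β := BddFam.ofHom fun i =>
  ((braiding ζ i.2.deg i.1.deg).conjStarAlgEquiv :
    (Ell2 (i.2.S × i.1.S) →L[ℂ] Ell2 (i.2.S × i.1.S)) →⋆ₐ[ℂ] Ops α β i).comp
      ((amp i.2.S i.1.S).comp i.2.φ)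

/-- The braided tensor product as a closed ⋆-subalgebra of the bounded families of operators. -/
def subalg : StarSubalgebra ℂ (Fam α β) :=
  (StarAlgebra.adjoin ℂ (Set.range (leg₁ α β) ∪ Set.range (leg₂ ζ α β))).topologicalClosure

/-- The braided tensor product `A ⊠_ζ B` of C⋆-algebras with circle actions: the C⋆-algebra
generated by `a ⊗ 1` and `𝔅 (b ⊗ 1) 𝔅⋆` in the direct sum of all pairs of covariant
representations of `A` and `B`. -/
def Tensor : Type (max (u + 1) (v + 1)) := subalg ζ α β

theorem isClosed_subalg : IsClosed (subalg ζ α β : Set (Fam α β)) :=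
  StarSubalgebra.isClosed_topologicalClosure _

instance : CStarAlgebra (Tensor ζ α β) :=
  StarSubalgebra.cstarAlgebra (subalg ζ α β) (h_closed := isClosed_subalg ζ α β)

/-- The canonical embedding of the first factor. -/
def j₁ : A →⋆ₐ[ℂ] Tensor ζ α β :=
  (leg₁ α β).codRestrict _ fun a => StarSubalgebra.le_topologicalClosure _
    (StarAlgebra.subset_adjoin ℂ _ (Or.inl ⟨a, rfl⟩))

/-- The canonical embedding of the second factor. -/
def j₂ : B →⋆ₐ[ℂ] Tensor ζ α β :=
  (leg₂ ζ α β).codRestrict _ fun b => StarSubalgebra.le_topologicalClosure _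
    (StarAlgebra.subset_adjoin ℂ _ (Or.inr ⟨b, rfl⟩))

/-- The inclusion of the braided tensor product into the bounded families of operators. -/
def toFam : Tensor ζ α β →⋆ₐ[ℂ] Fam α β := (subalg ζ α β).subtype

theorem toFam_injective : Function.Injective (toFam ζ α β) := Subtype.val_injective

theorem isClosedEmbedding_toFam : Topology.IsClosedEmbedding (toFam ζ α β) :=
  (isClosed_subalg ζ α β).isClosedEmbedding_subtypeVal

theorem toFam_j₁ (a : A) : toFam ζ α β (j₁ ζ α β a) = leg₁ α β a := rfl
theorem toFam_j₂ (b : B) : toFam ζ α β (j₂ ζ α β b) = leg₂ ζ α β b := rfl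

end Braided

namespace Braided

universe u v

section Map

variable {A A' : Type u} {B B' : Type v} [CStarAlgebra A] [CStarAlgebra A'] [CStarAlgebra B]
  [CStarAlgebra B'] (ζ : Circle) {α : CircleAction A} {α' : CircleAction A'}
  {β : CircleAction B} {β' : CircleAction B'}

/-- Reindexing of bounded families along the pullback of covariant representations. -/
def famMap (f : A →⋆ₐ[ℂ] A') (hf : Equivariant α α' f) (g : B →⋆ₐ[ℂ] B')
    (hg : Equivariant β β' g) : Fam α β →⋆ₐ[ℂ] Fam α' β' :=
  BddFam.ofHom fun i : CovRep α' × CovRep β' =>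
    (BddFam.component (A := Ops α β) (i.1.comap f hf, i.2.comap g hg) :
      BddFam (Ops α β) →⋆ₐ[ℂ] Ops α' β' i)

theorem famMap_leg₁ (f : A →⋆ₐ[ℂ] A') (hf : Equivariant α α' f) (g : B →⋆ₐ[ℂ] B')
    (hg : Equivariant β β' g) (a : A) : famMap f hf g hg (leg₁ α β a) = leg₁ α' β' (f a) := rfl

theorem famMap_leg₂ (f : A →⋆ₐ[ℂ] A') (hf : Equivariant α α' f) (g : B →⋆ₐ[ℂ] B')
    (hg : Equivariant β β' g) (b : B) :
    famMap f hf g hg (leg₂ ζ α β b) = leg₂ ζ α' β' (g b) := rfl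

theorem famMap_mem (f : A →⋆ₐ[ℂ] A') (hf : Equivariant α α' f) (g : B →⋆ₐ[ℂ] B')
    (hg : Equivariant β β' g) (x : Tensor ζ α β) :
    famMap f hf g hg (toFam ζ α β x) ∈ subalg ζ α' β' := by
  have h : subalg ζ α β ≤ (subalg ζ α' β').comap (famMap f hf g hg) := by
    have hc : IsClosed ((subalg ζ α' β').comap (famMap f hf g hg) : Set (Fam α β)) :=
      (isClosed_subalg ζ α' β').preimage (continuous_starHom (famMap f hf g hg))
    refine StarSubalgebra.topologicalClosure_minimal ?_ hc
    refine StarAlgebra.adjoin_le ?_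
    rintro _ (⟨a, rfl⟩ | ⟨b, rfl⟩)
    · exact (j₁ ζ α' β' (f a)).2
    · exact (j₂ ζ α' β' (g b)).2
  exact h x.2

/-- The functoriality of the braided tensor product: the unique ⋆-homomorphism `f ⊠ g` that maps
`j₁ a` to `j₁ (f a)` and `j₂ b` to `j₂ (g b)`. -/
def map (f : A →⋆ₐ[ℂ] A') (hf : Equivariant α α' f) (g : B →⋆ₐ[ℂ] B')
    (hg : Equivariant β β' g) : Tensor ζ α β →⋆ₐ[ℂ] Tensor ζ α' β' :=
  ((famMap f hf g hg).comp (toFam ζ α β)).codRestrict (subalg ζ α' β') (famMap_mem ζ f hf g hg)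

theorem map_j₁ (f : A →⋆ₐ[ℂ] A') (hf : Equivariant α α' f) (g : B →⋆ₐ[ℂ] B')
    (hg : Equivariant β β' g) (a : A) : map ζ f hf g hg (j₁ ζ α β a) = j₁ ζ α' β' (f a) := rfl

theorem map_j₂ (f : A →⋆ₐ[ℂ] A') (hf : Equivariant α α' f) (g : B →⋆ₐ[ℂ] B')
    (hg : Equivariant β β' g) (b : B) : map ζ f hf g hg (j₂ ζ α β b) = j₂ ζ α' β' (g b) := rfl

end Map

section Commutation

/-- The operator `1 ⊗ y`. -/
def ampRight {S T : Type*} (y : Ell2 T →L[ℂ] Ell2 T) : Ell2 (S × T) →L[ℂ] Ell2 (S × T) :=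
  (monomialUnitary (Equiv.prodComm T S) fun _ => 1).conjStarAlgEquiv (amp T S y)

/-- The slice `f (s, ·)`. -/
def rslice {S T : Type*} (f : Ell2 (S × T)) (s : S) : Ell2 T :=
  slice ((monomialUnitary (Equiv.prodComm T S) fun _ => 1).symm f) s

theorem rslice_apply {S T : Type*} (f : Ell2 (S × T)) (s : S) (t : T) :
    rslice f s t = f (s, t) := by
  unfold rslice
  rw [slice_apply, monomialUnitary_symm_apply]
  simp

theorem ampRight_apply {S T : Type*} (y : Ell2 T →L[ℂ] Ell2 T) (f : Ell2 (S × T)) (s : S) (t : T) :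
    ampRight y f (s, t) = y (rslice f s) t := by
  unfold ampRight rslice
  rw [LinearIsometryEquiv.conjStarAlgEquiv_apply_apply, monomialUnitary_apply]
  simp [amp_apply]

theorem amp_ampRight {S T : Type*} (x : Ell2 S →L[ℂ] Ell2 S) (y : Ell2 T →L[ℂ] Ell2 T) :
    amp S T x * ampRight y = ampRight y * amp S T x := by
  classical
  refine lp.ext_continuousLinearMap (𝕜 := ℂ) (by norm_num) fun p => ?_
  obtain ⟨s₀, t₀⟩ := p
  ext : 1
  set f : Ell2 (S × T) := lp.single 2 (s₀, t₀) (1 : ℂ) with hf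
  change amp S T x (ampRight y f) = ampRight y (amp S T x f)
  have h1 : ∀ t, slice f t = (if t = t₀ then (1 : ℂ) else 0) • lp.single 2 s₀ (1 : ℂ) := by
    intro t
    ext s
    rw [slice_apply, hf]
    by_cases hs : s = s₀ <;> by_cases ht : t = t₀ <;>
      simp [lp.single_apply, hs, ht]
  have h2 : ∀ s, rslice f s = (if s = s₀ then (1 : ℂ) else 0) • lp.single 2 t₀ (1 : ℂ) := by
    intro s
    ext t
    rw [rslice_apply, hf]
    by_cases hs : s = s₀ <;> by_cases ht : t = t₀ <;>
      simp [lp.single_apply, hs, ht]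
  have h3 : ∀ s, rslice (amp S T x f) s =
      (x (lp.single 2 s₀ (1 : ℂ)) s) • lp.single 2 t₀ (1 : ℂ) := by
    intro s
    ext t
    rw [rslice_apply, amp_apply, h1, map_smul]
    by_cases ht : t = t₀ <;> simp [lp.single_apply, ht]
  have h4 : ∀ t, slice (ampRight y f) t =
      (y (lp.single 2 t₀ (1 : ℂ)) t) • lp.single 2 s₀ (1 : ℂ) := by
    intro t
    ext s
    rw [slice_apply, ampRight_apply, h2, map_smul]
    by_cases hs : s = s₀ <;> simp [lp.single_apply, hs]
  ext ⟨s, t⟩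
  rw [amp_apply, ampRight_apply, h3, h4, map_smul, map_smul]
  simp [mul_comm]

variable {A : Type u} {B : Type v} [CStarAlgebra A] [CStarAlgebra B]
  (ζ : Circle) (α : CircleAction A) (β : CircleAction B)

/-- On homogeneous elements `b` of degree `l`, the second leg is `D ⊗ b` with the circle
representation `D` at `ζ ^ l` on the first Hilbert space. -/
theorem leg₂_homogeneous {b : B} {l : ℤ}
    (hb : ∀ z : Circle, β.toHom z b = ((z ^ l : Circle) : ℂ) • b) (i : CovRep α × CovRep β) :
    (braiding ζ i.2.deg i.1.deg).conjStarAlgEquiv (amp i.2.S i.1.S (i.2.φ b)) =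
      amp i.1.S i.2.S (circleUnitary i.1.deg (ζ ^ l) : Ell2 i.1.S →L[ℂ] Ell2 i.1.S) *
        ampRight (i.2.φ b) := by
  ext f ⟨s, t⟩
  rw [LinearIsometryEquiv.conjStarAlgEquiv_apply_apply, braiding, monomialUnitary_apply]
  change _ = amp i.1.S i.2.S _ (ampRight (i.2.φ b) f) (s, t)
  rw [amp_apply]
  change _ = circleUnitary i.1.deg (ζ ^ l) (slice (ampRight (i.2.φ b) f) t) s
  rw [circleUnitary_apply, slice_apply, ampRight_apply]
  simp only [Equiv.prodComm_symm, Equiv.prodComm_apply, Prod.swap_prod_mk]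
  have h := i.2.covariant (ζ ^ i.1.deg s) b
  rw [hb, map_smul] at h
  have h' := congrArg (fun T => (T (rslice f s)) t) h
  simp only [LinearIsometryEquiv.conjStarAlgEquiv_apply_apply] at h'
  rw [circleUnitary_apply] at h'
  have h5 : (circleUnitary i.2.deg (ζ ^ i.1.deg s)).symm (rslice f s) =
      slice ((monomialUnitary (Equiv.prodComm i.2.S i.1.S)
        fun x => ζ ^ (i.2.deg x.1 * i.1.deg x.2)).symm f) s := by
    ext t
    rw [circleUnitary_symm_apply, slice_apply, monomialUnitary_symm_apply, rslice_apply]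
    simp [← zpow_mul, mul_comm]
  rw [h5] at h'
  have h6 : (((ζ ^ i.1.deg s) ^ l : Circle) : ℂ) * (i.2.φ b (rslice f s)) t =
      (((ζ ^ l) ^ i.1.deg s : Circle) : ℂ) * (i.2.φ b (rslice f s)) t := by
    rw [← zpow_mul, ← zpow_mul, mul_comm l]
  rw [mul_comm (i.2.deg t), zpow_mul]
  exact h'.symm.trans h6

/-- The commutation relation of the two legs of the braided tensor product. -/
theorem commutation {a : A} {b : B} {k l : ℤ}
    (ha : ∀ z : Circle, α.toHom z a = ((z ^ k : Circle) : ℂ) • a)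
    (hb : ∀ z : Circle, β.toHom z b = ((z ^ l : Circle) : ℂ) • b) :
    j₁ ζ α β a * j₂ ζ α β b = ((ζ ^ (-(k * l)) : Circle) : ℂ) • (j₂ ζ α β b * j₁ ζ α β a) := by
  apply toFam_injective
  rw [map_smul, map_mul, map_mul]
  refine BddFam.ext (A := Ops α β) fun i => ?_
  change amp i.1.S i.2.S (i.1.φ a) *
      (braiding ζ i.2.deg i.1.deg).conjStarAlgEquiv (amp i.2.S i.1.S (i.2.φ b)) =
    ((ζ ^ (-(k * l)) : Circle) : ℂ) •
      ((braiding ζ i.2.deg i.1.deg).conjStarAlgEquiv (amp i.2.S i.1.S (i.2.φ b)) *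
        amp i.1.S i.2.S (i.1.φ a))
  rw [leg₂_homogeneous ζ α β hb i]
  set D : Ell2 i.1.S →L[ℂ] Ell2 i.1.S :=
    (circleUnitary i.1.deg (ζ ^ l) : Ell2 i.1.S →L[ℂ] Ell2 i.1.S) with hD
  have h : D * i.1.φ a = ((ζ ^ (k * l) : Circle) : ℂ) • (i.1.φ a * D) := by
    have h := i.1.covariant (ζ ^ l) a
    rw [ha, map_smul, ← zpow_mul, mul_comm l k] at h
    ext1 f
    have h' := congrArg (fun T => T (D f)) h
    simp only [LinearIsometryEquiv.conjStarAlgEquiv_apply_apply] at h'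
    change D (i.1.φ a f) = ((ζ ^ (k * l) : Circle) : ℂ) • i.1.φ a (D f)
    refine Eq.trans ?_ h'.symm
    change _ = D (i.1.φ a ((circleUnitary _ _).symm (circleUnitary _ _ f)))
    rw [LinearIsometryEquiv.symm_apply_apply]
  rw [mul_assoc, ← amp_ampRight, ← mul_assoc, ← mul_assoc, ← map_mul, ← map_mul, h, map_smul,
    smul_mul_assoc, smul_smul, ← Circle.coe_mul, ← zpow_add, neg_add_cancel, zpow_zero,
    Circle.coe_one, one_smul]

end Commutation

end Braided

/-! ### The circle action and the comultiplication of `A_o(V, π, ω)` -/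

theorem coe_zpow_mul (z : Circle) (k l : ℤ) :
    ((z ^ k : Circle) : ℂ) * ((z ^ l : Circle) : ℂ) = ((z ^ (k + l) : Circle) : ℂ) := by
  rw [← Circle.coe_mul, ← zpow_add]

theorem star_coe_zpow (z : Circle) (k : ℤ) :
    star ((z ^ k : Circle) : ℂ) = ((z ^ (-k) : Circle) : ℂ) := by
  rw [zpow_neg, Circle.coe_inv_eq_conj]
  rfl

theorem continuous_coe_zpow (k : ℤ) : Continuous fun z : Circle => ((z ^ k : Circle) : ℂ) :=
  Continuous.comp (g := fun z : Circle => (z : ℂ)) continuous_subtype_val (continuous_zpow k)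

theorem coe_zpow_smul_smul {M : Type*} [AddCommGroup M] [Module ℂ M] (z : Circle) (k l : ℤ)
    (x : M) : ((z ^ k : Circle) : ℂ) • ((z ^ l : Circle) : ℂ) • x =
      ((z ^ (k + l) : Circle) : ℂ) • x := by
  rw [smul_smul, coe_zpow_mul]

namespace Datum

variable {ζ : Circle} {n : ℕ} {V : Type*} [NormedAddCommGroup V] [InnerProductSpace ℂ V]
  {e : OrthonormalBasis (Fin n) ℂ V} (D : Datum ζ e)

/-- The relations are homogeneous for the grading in which `u i j` has degree `deg j - deg i`. -/
theorem Relations.twist {D : Datum ζ e} {B : Type*} [CStarAlgebra B] {u : Fin n → Fin n → B}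
    (hu : D.Relations u) (z : Circle) :
    D.Relations fun i j => ((z ^ (D.deg j - D.deg i) : Circle) : ℂ) • u i j where
  isometry i j := by
    have h : ∀ k, star (((z ^ (D.deg i - D.deg k) : Circle) : ℂ) • u k i) *
        (((z ^ (D.deg j - D.deg k) : Circle) : ℂ) • u k j) =
        ((z ^ (D.deg j - D.deg i) : Circle) : ℂ) • (star (u k i) * u k j) := by
      intro k
      rw [star_smul, star_coe_zpow, smul_mul_smul_comm, coe_zpow_mul]
      congr 3
      ring_nf
    simp_rw [h]
    rw [← Finset.smul_sum, hu.isometry]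
    split_ifs with hij
    · simp [hij]
    · simp
  coisometry i j := by
    have h : ∀ k, (((z ^ (D.deg k - D.deg i) : Circle) : ℂ) • u i k) *
        star (((z ^ (D.deg k - D.deg j) : Circle) : ℂ) • u j k) =
        ((z ^ (D.deg j - D.deg i) : Circle) : ℂ) • (u i k * star (u j k)) := by
      intro k
      rw [star_smul, star_coe_zpow, smul_mul_smul_comm, coe_zpow_mul]
      congr 3
      ring_nf
    simp_rw [h]
    rw [← Finset.smul_sum, hu.coisometry]
    split_ifs with hij
    · simp [hij]
    · simp
  invariant i j := by
    have h1 : ∀ k, D.coeff i k • ((z ^ (D.deg k - D.deg j) : Circle) : ℂ) • u j k =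
        ((z ^ (D.d - D.deg i - D.deg j) : Circle) : ℂ) • D.coeff i k • u j k := by
      intro k
      by_cases hk : D.coeff i k = 0
      · simp [hk]
      · rw [smul_comm, ← D.deg_add_deg hk]
        congr 3
        ring_nf
    have h2 : ∀ k, D.coeff k j • star (((z ^ (D.deg i - D.deg k) : Circle) : ℂ) • u k i) =
        ((z ^ (D.d - D.deg i - D.deg j) : Circle) : ℂ) • D.coeff k j • star (u k i) := by
      intro k
      by_cases hk : D.coeff k j = 0
      · simp [hk]
      · rw [star_smul, star_coe_zpow, smul_comm, ← D.deg_add_deg hk]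
        congr 3
        ring_nf
    simp_rw [h1, h2]
    rw [← Finset.smul_sum, ← Finset.smul_sum, smul_comm, hu.invariant, smul_comm]

/-- The ⋆-endomorphism `u i j ↦ z ^ (deg j - deg i) • u i j` of `A_o(V, π, ω)`. -/
def actHom (z : Circle) : D.Ao →⋆ₐ[ℂ] D.Ao := D.lift _ (D.relations_u.twist z)

@[simp] theorem actHom_u (z : Circle) (i j : Fin n) :
    D.actHom z (D.u i j) = ((z ^ (D.deg j - D.deg i) : Circle) : ℂ) • D.u i j := D.lift_u _ _ i j

theorem continuous_actHom (a : D.Ao) : Continuous fun z => D.actHom z a := by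
  induction a using D.Ao_induction with
  | hc =>
    refine isClosed_of_closure_subset fun a ha => ?_
    refine continuous_of_uniform_approx_of_continuous fun U hU => ?_
    obtain ⟨ε, hε, hU⟩ := Metric.mem_uniformity_dist.1 hU
    obtain ⟨b, hb, hab⟩ := Metric.mem_closure_iff.1 ha ε hε
    refine ⟨_, hb, fun z => hU ?_⟩
    rw [dist_eq_norm, ← map_sub]
    exact (NonUnitalStarAlgHom.norm_apply_le (D.actHom z) (a - b)).trans_lt
      (by rwa [← dist_eq_norm])
  | h1 c => simpa only [AlgHomClass.commutes] using continuous_const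
  | h2 i j =>
    simp only [actHom_u]
    exact (continuous_coe_zpow _).smul continuous_const
  | h2' i j =>
    simp only [map_star, actHom_u]
    exact ((continuous_coe_zpow _).smul continuous_const).star
  | h3 a b ha hb => simp only [map_mul]; exact ha.mul hb
  | h4 a b ha hb => simp only [map_add]; exact ha.add hb

/-- The continuous circle action on `A_o(V, π, ω)` with `z • u i j = z ^ (deg j - deg i) • u i j`. -/
def action : CircleAction D.Ao where
  toHom :=
    { toFun := D.actHom
      map_one' := D.hom_ext fun i j => by
        rw [actHom_u, one_zpow, Circle.coe_one, one_smul]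
        rfl
      map_mul' := fun z w => D.hom_ext fun i j => by
        change _ = D.actHom z (D.actHom w (D.u i j))
        rw [actHom_u, actHom_u, map_smul, actHom_u, smul_smul, mul_comm z w, mul_zpow,
          Circle.coe_mul] }
  continuous_orbit := D.continuous_actHom

theorem action_u (z : Circle) (i j : Fin n) :
    D.action.toHom z (D.u i j) = ((z ^ (D.deg j - D.deg i) : Circle) : ℂ) • D.u i j :=
  D.actHom_u z i j

theorem action_star_u (z : Circle) (i j : Fin n) :
    D.action.toHom z (star (D.u i j)) =
      ((z ^ (D.deg i - D.deg j) : Circle) : ℂ) • star (D.u i j) := by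
  rw [map_star, action_u, star_smul, star_coe_zpow, neg_sub]

/-- Products of two solutions of the relations in braided position solve the relations. -/
theorem Relations.braidedMul {D : Datum ζ e} {B : Type*} [CStarAlgebra B]
    {a b : Fin n → Fin n → B} (ha : D.Relations a) (hb : D.Relations b)
    (hab : ∀ i j k l, a i j * star (b k l) =
      ((ζ ^ (-((D.deg j - D.deg i) * (D.deg k - D.deg l))) : Circle) : ℂ) •
        (star (b k l) * a i j)) :
    D.Relations fun i k => ∑ l, a i l * b l k where
  isometry i j := by
    calc _ = ∑ k, ∑ l, ∑ m, star (b l i) * (star (a k l) * a k m) * b m j := by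
          refine Finset.sum_congr rfl fun k _ => ?_
          rw [star_sum, Finset.sum_mul_sum]
          refine Finset.sum_congr rfl fun l _ => Finset.sum_congr rfl fun m _ => ?_
          rw [star_mul]
          noncomm_ring
      _ = ∑ l, ∑ m, star (b l i) * (∑ k, star (a k l) * a k m) * b m j := by
          rw [Finset.sum_comm]
          refine Finset.sum_congr rfl fun l _ => ?_
          rw [Finset.sum_comm]
          refine Finset.sum_congr rfl fun m _ => ?_
          rw [Finset.mul_sum, Finset.sum_mul]
      _ = ∑ l, star (b l i) * b l j := by
          refine Finset.sum_congr rfl fun l _ => ?_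
          simp [ha.isometry]
      _ = _ := hb.isometry i j
  coisometry i j := by
    calc _ = ∑ k, ∑ l, ∑ m, a i l * (b l k * star (b m k)) * star (a j m) := by
          refine Finset.sum_congr rfl fun k _ => ?_
          rw [star_sum, Finset.sum_mul_sum]
          refine Finset.sum_congr rfl fun l _ => Finset.sum_congr rfl fun m _ => ?_
          rw [star_mul]
          noncomm_ring
      _ = ∑ l, ∑ m, a i l * (∑ k, b l k * star (b m k)) * star (a j m) := by
          rw [Finset.sum_comm]
          refine Finset.sum_congr rfl fun l _ => ?_
          rw [Finset.sum_comm]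
          refine Finset.sum_congr rfl fun m _ => ?_
          rw [Finset.mul_sum, Finset.sum_mul]
      _ = ∑ l, a i l * star (a j l) := by
          refine Finset.sum_congr rfl fun l _ => ?_
          simp [hb.coisometry]
      _ = _ := ha.coisometry i j
  invariant i j := by
    have hb' : ∀ l, ∑ k, D.coeff i k • b l k =
        ((ζ ^ (D.deg l * (D.d - D.deg l) - D.deg l * D.deg i) : Circle) : ℂ) •
          ∑ k, D.coeff k l • star (b k i) := by
      intro l
      have h := congrArg (fun x => ((ζ ^ (-(D.deg l * D.deg i)) : Circle) : ℂ) • x)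
        (hb.invariant i l)
      simp only [coe_zpow_smul_smul, neg_add_cancel, zpow_zero, Circle.coe_one, one_smul] at h
      rw [h]
      congr 3
      ring_nf
    have key : ∀ l k, ((ζ ^ (D.deg j * D.deg i) : Circle) : ℂ) •
        ((ζ ^ (D.deg l * (D.d - D.deg l) - D.deg l * D.deg i) : Circle) : ℂ) •
          D.coeff k l • (a j l * star (b k i)) =
        star (b k i) * ((ζ ^ (D.deg j * D.deg k) : Circle) : ℂ) • D.coeff k l • a j l := by
      intro l k
      by_cases hk : D.coeff k l = 0
      · simp [hk]
      · rw [hab, smul_comm (D.coeff k l), coe_zpow_smul_smul, coe_zpow_smul_smul,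
          mul_smul_comm, mul_smul_comm, ← D.deg_add_deg hk]
        congr 3
        ring_nf
    calc _ = ∑ l, ((ζ ^ (D.deg j * D.deg i) : Circle) : ℂ) •
            (a j l * ∑ k, D.coeff i k • b l k) := by
          rw [← Finset.smul_sum]
          congr 1
          simp_rw [Finset.smul_sum, Finset.mul_sum]
          rw [Finset.sum_comm]
          simp_rw [mul_smul_comm]
      _ = ∑ l, ∑ k, star (b k i) * ((ζ ^ (D.deg j * D.deg k) : Circle) : ℂ) •
            D.coeff k l • a j l := by
          refine Finset.sum_congr rfl fun l _ => ?_
          rw [hb' l, mul_smul_comm, Finset.mul_sum, Finset.smul_sum, Finset.smul_sum]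
          refine Finset.sum_congr rfl fun k _ => ?_
          rw [mul_smul_comm, key]
      _ = ∑ k, star (b k i) * (((ζ ^ (D.deg j * D.deg k) : Circle) : ℂ) •
            ∑ l, D.coeff k l • a j l) := by
          rw [Finset.sum_comm]
          refine Finset.sum_congr rfl fun k _ => ?_
          rw [← Finset.mul_sum, Finset.smul_sum]
      _ = ∑ k, star (b k i) * (((ζ ^ (D.deg j * (D.d - D.deg j)) : Circle) : ℂ) •
            ∑ m, D.coeff m j • star (a m k)) := by
          refine Finset.sum_congr rfl fun k _ => ?_
          rw [ha.invariant]
      _ = _ := by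
          simp_rw [mul_smul_comm]
          rw [← Finset.smul_sum]
          congr 1
          simp_rw [Finset.mul_sum, star_sum, star_mul, Finset.smul_sum, mul_smul_comm]
          rw [Finset.sum_comm]

/-- The braided tensor square of `A_o(V, π, ω)`. -/
abbrev AoTensor : Type 1 := Braided.Tensor ζ D.action D.action

theorem relations_comul : D.Relations fun i k =>
    ∑ l, Braided.j₁ ζ D.action D.action (D.u i l) * Braided.j₂ ζ D.action D.action (D.u l k) :=
  (D.relations_u.map D (Braided.j₁ ζ D.action D.action)).braidedMul
    (D.relations_u.map D (Braided.j₂ ζ D.action D.action)) fun i j k l => by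
      rw [← map_star]
      exact Braided.commutation ζ D.action D.action (fun z => D.action_u z i j)
        (fun z => D.action_star_u z k l)

/-- The comultiplication of the braided quantum group `A_o(V, π, ω)`, determined by
`comul (u i k) = ∑ l, j₁ (u i l) * j₂ (u l k)`. -/
def comul : D.Ao →⋆ₐ[ℂ] D.AoTensor := D.lift _ D.relations_comul

theorem comul_u (i k : Fin n) : D.comul (D.u i k) =
    ∑ l, Braided.j₁ ζ D.action D.action (D.u i l) * Braided.j₂ ζ D.action D.action (D.u l k) :=
  D.lift_u _ _ i k

end Datum

end BraidedOrth

end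

open scoped TensorProduct

namespace BraidedOrth

/-! Write $d_i$ for the degrees and $\omega_{ij}$ for the coefficients. The point is that the two
algebras have equivalent defining relations on the same generators. Unitarity of $u$ does not
involve the datum, so only the invariance relation has to be compared. Homogeneity makes
$\omega_{ik}$ vanish unless $d_i+d_k=d$ (`deg_add_deg`). On this support the left side for the
shifted datum carries the exponent $(d_j-s)(d_i-s)-sd_k=d_jd_i+(s^2-sd_j-sd)$. The right side
carries $(d_j-s)(d-s-d_j)-sd_j=d_j(d-d_j)+(s^2-sd_j-sd)$. Hence the shifted relation for $(i,j)$ is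
the original one multiplied by the unimodular scalar $\zeta^{s^2-sd_j-sd}$. This is
`relations_shift_iff`; the twist $\zeta^{-sd_j}$ in $\omega'$ is what makes the two extra exponents
agree.

The universal properties then give mutually inverse ⋆-homomorphisms that fix the generators. The
action involves only the differences $d_j-d_i$, which the shift does not change, so the isomorphism
is equivariant. The braided tensor product is built from $\zeta$ and the actions alone and is
functorial for equivariant maps. Both composites in the comultiplication identity are therefore
⋆-homomorphisms on $A_o(V,\pi,\omega)$, and they agree on generators.

It remains to check that the shifted data are admissible (`shift`). The same support condition gives
the degree $d-2s$ of $\omega'$. It also gives $\overline{\Omega'}\Omega'=c'\pi'_{\zeta^{d-2s}}$ with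
$c'=c\,\zeta^{2sd-2s^2}$ (`shift_condition`). -/

theorem coeffMatrix_sum {n : ℕ} {V : Type*} [NormedAddCommGroup V] [InnerProductSpace ℂ V]
    (e : OrthonormalBasis (Fin n) ℂ V) (c : Fin n → Fin n → ℂ) (i j : Fin n) :
    coeffMatrix e (∑ k, ∑ l, c k l • (e k ⊗ₜ[ℂ] e l)) i j = c i j := by
  -- As a single sum over pairs, this is an expansion in the product basis, whose coordinates
  -- `repr_sum_self` returns.
  have h : ∑ k, ∑ l, c k l • (e k ⊗ₜ[ℂ] e l) =
      ∑ x : Fin n × Fin n, c x.1 x.2 • (e.toBasis.tensorProduct e.toBasis) x := by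
    rw [Fintype.sum_prod_type]
    simp [Module.Basis.tensorProduct_apply]
  rw [h, coeffMatrix, Matrix.of_apply]
  exact (e.toBasis.tensorProduct e.toBasis).repr_sum_self _ ▸ rfl

namespace Datum

variable {ζ : Circle} {n : ℕ} {V : Type*} [NormedAddCommGroup V] [InnerProductSpace ℂ V]
  {e : OrthonormalBasis (Fin n) ℂ V} (D : Datum ζ e)

/-! ### The shifted datum -/

theorem toMatrix_rep (z : Circle) (i j : Fin n) :
    LinearMap.toMatrix e.toBasis e.toBasis (D.rep z) i j =
      if i = j then ((z ^ D.deg j : Circle) : ℂ) else 0 := by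
  rw [LinearMap.toMatrix_apply, e.coe_toBasis, D.rep_basis, ← e.coe_toBasis, map_smul,
    Module.Basis.repr_self, Finsupp.smul_apply, Finsupp.single_apply]
  simp [eq_comm]

/-- The representation `z ↦ z ^ (-s) • π z`. -/
noncomputable def shiftRep (s : ℤ) : Representation ℂ Circle V where
  toFun z := ((z ^ (-s) : Circle) : ℂ) • D.rep z
  map_one' := by simp
  map_mul' z w := by
    rw [map_mul, smul_mul_smul_comm, mul_zpow, Circle.coe_mul]

theorem shiftRep_apply (s : ℤ) (z : Circle) (v : V) :
    D.shiftRep s z v = ((z ^ (-s) : Circle) : ℂ) • D.rep z v := rfl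

theorem shiftRep_basis (s : ℤ) (z : Circle) (i : Fin n) :
    D.shiftRep s z (e i) = ((z ^ (D.deg i - s) : Circle) : ℂ) • e i := by
  rw [shiftRep_apply, rep_basis, coe_zpow_smul_smul]
  congr 3
  ring

/-- The coefficients of the twisted vector `ω'`. -/
noncomputable def shiftCoeff (s : ℤ) (i j : Fin n) : ℂ :=
  ((ζ ^ (-(s * D.deg j)) : Circle) : ℂ) * D.coeff i j

/-- The twists contribute $\zeta^{sd_k-sd_j}$ to the $k$-th summand. Where $\omega_{kj}\neq0$ one
has $d_k=d-d_j$, so this factor is $\zeta^{sd-2sd_j}$; it does not depend on $k$ and leaves the sum.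
What remains is an entry of the diagonal matrix $c\,\pi_{\zeta^d}$. The scalar $\zeta^{2sd-2s^2}$ is
the ratio of $\zeta^{sd-2sd_j}\zeta^{dd_j}$ to $\zeta^{(d-2s)(d_j-s)}$, in which $d_j$ cancels. -/
theorem shift_condition (s : ℤ) {c : ℂ}
    (h : (coeffMatrix e D.ω).map star * coeffMatrix e D.ω =
      c • LinearMap.toMatrix e.toBasis e.toBasis (D.rep (ζ ^ D.d))) (i j : Fin n) :
    ∑ k, star (D.shiftCoeff s i k) * D.shiftCoeff s k j =
      c * ((ζ ^ (2 * s * D.d - 2 * s * s) : Circle) : ℂ) *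
        (if i = j then (((ζ ^ (D.d - 2 * s)) ^ (D.deg j - s) : Circle) : ℂ) else 0) := by
  have h1 := congrFun (congrFun h i) j
  rw [Matrix.smul_apply, toMatrix_rep, Matrix.mul_apply] at h1
  change ∑ k, star (D.coeff i k) * D.coeff k j = _ at h1
  have h2 : ∀ k, star (D.shiftCoeff s i k) * D.shiftCoeff s k j =
      ((ζ ^ (s * D.d - 2 * s * D.deg j) : Circle) : ℂ) * (star (D.coeff i k) * D.coeff k j) := by
    intro k
    -- Off the support of $\omega$ both sides vanish. On it, $d$ may be replaced by $d_k+d_j$, after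
    -- which the exponents match identically.
    by_cases hk : D.coeff k j = 0
    · simp [shiftCoeff, hk]
    · have h3 : s * D.d - 2 * s * D.deg j = s * D.deg k + -(s * D.deg j) := by
        rw [← D.deg_add_deg hk]
        ring
      rw [shiftCoeff, shiftCoeff, star_mul, star_coe_zpow, neg_neg, h3, ← coe_zpow_mul]
      ring
  simp_rw [h2]
  rw [← Finset.mul_sum, h1]
  split_ifs with hij
  -- The diagonal case reduces to $(sd-2sd_j)+dd_j=(2sd-2s^2)+(d-2s)(d_j-s)$.
  · rw [smul_eq_mul, mul_left_comm, ← zpow_mul, ← zpow_mul, coe_zpow_mul, mul_assoc c,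
      coe_zpow_mul]
    congr 3
    ring
  · simp

/-- The datum with degrees `deg i - s`, obtained by tensoring `π` with the character `z ^ (-s)`. -/
noncomputable def shift (s : ℤ) : Datum ζ e where
  rep := D.shiftRep s
  deg i := D.deg i - s
  rep_basis := D.shiftRep_basis s
  ω := ∑ i, ∑ j, D.shiftCoeff s i j • (e i ⊗ₜ[ℂ] e j)
  d := D.d - 2 * s
  homogeneous z := by
    simp only [map_sum, map_smul, TensorProduct.map_tmul, shiftRep_basis, Finset.smul_sum,
      TensorProduct.smul_tmul_smul, coe_zpow_mul]
    refine Finset.sum_congr rfl fun i _ => Finset.sum_congr rfl fun j _ => ?_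
    -- Each surviving term has degree $(d_i-s)+(d_j-s)=d-2s$, since $d_i+d_j=d$ wherever the
    -- coefficient is non-zero.
    by_cases h : D.coeff i j = 0
    · simp [shiftCoeff, h]
    · rw [smul_comm, ← D.deg_add_deg h]
      congr 3
      ring
  condition := by
    obtain ⟨c, hc, h⟩ := D.condition
    refine ⟨c * ((ζ ^ (2 * s * D.d - 2 * s * s) : Circle) : ℂ),
      mul_ne_zero hc (Circle.coe_ne_zero _), ?_⟩
    ext i j
    -- `toMatrix_rep` speaks of a complete datum, and this one is still under construction, so the
    -- matrix of `shiftRep` is computed directly from its eigenvectors.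
    rw [Matrix.mul_apply, Matrix.smul_apply, LinearMap.toMatrix_apply, e.coe_toBasis,
      shiftRep_basis, ← e.coe_toBasis, map_smul, Module.Basis.repr_self, Finsupp.smul_apply,
      Finsupp.single_apply]
    simp only [Matrix.map_apply, e.coe_toBasis, coeffMatrix_sum]
    rw [D.shift_condition s h]
    simp [eq_comm]

theorem shift_deg (s : ℤ) (i : Fin n) : (D.shift s).deg i = D.deg i - s := rfl

theorem shift_d (s : ℤ) : (D.shift s).d = D.d - 2 * s := rfl

/-- The relations see $\omega'$ only through its coefficients in the basis, whereas `shift` gives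
$\omega'$ as a tensor; this passes from one to the other. -/
theorem shift_coeff (s : ℤ) (i j : Fin n) :
    (D.shift s).coeff i j = ((ζ ^ (-(s * D.deg j)) : Circle) : ℂ) * D.coeff i j :=
  coeffMatrix_sum e (D.shiftCoeff s) i j

/-! ### Comparison of the defining relations -/

/-- The relations for a datum and for its shift are equivalent. -/
theorem relations_shift_iff (s : ℤ) {B : Type*} [Ring B] [StarRing B] [Algebra ℂ B]
    (u : Fin n → Fin n → B) : (D.shift s).Relations u ↔ D.Relations u := by
  -- The extra exponent on the left is initially $s^2-sd_j-s(d_i+d_k)$, which depends on the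
  -- summation index $k$. Homogeneity turns $d_i+d_k$ into $d$ wherever $\omega_{ik}\neq0$, so the
  -- factor becomes common to all terms.
  have hL : ∀ i j, (((ζ ^ ((D.shift s).deg j * (D.shift s).deg i) : Circle) : ℂ) •
      ∑ k, (D.shift s).coeff i k • u j k) = ((ζ ^ (s * s - s * D.deg j - s * D.d) : Circle) : ℂ) •
        ((ζ ^ (D.deg j * D.deg i) : Circle) : ℂ) • ∑ k, D.coeff i k • u j k := by
    intro i j
    simp only [Finset.smul_sum]
    refine Finset.sum_congr rfl fun k _ => ?_
    by_cases hk : D.coeff i k = 0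
    · simp [shift_coeff, hk]
    · rw [shift_coeff, mul_smul, coe_zpow_smul_smul, coe_zpow_smul_smul, shift_deg, shift_deg,
        ← D.deg_add_deg hk]
      congr 3
      ring
  -- Here the twist is $\zeta^{-sd_j}$ with $j$ fixed, so the exponents agree term by term without
  -- homogeneity. The common factor is the same as in `hL`.
  have hR : ∀ i j, (((ζ ^ ((D.shift s).deg j * ((D.shift s).d - (D.shift s).deg j)) : Circle) : ℂ) •
      ∑ k, (D.shift s).coeff k j • star (u k i)) =
        ((ζ ^ (s * s - s * D.deg j - s * D.d) : Circle) : ℂ) •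
        ((ζ ^ (D.deg j * (D.d - D.deg j)) : Circle) : ℂ) • ∑ k, D.coeff k j • star (u k i) := by
    intro i j
    simp only [Finset.smul_sum]
    refine Finset.sum_congr rfl fun k _ => ?_
    rw [shift_coeff, mul_smul, coe_zpow_smul_smul, coe_zpow_smul_smul, shift_deg, shift_d]
    congr 3
    ring
  constructor
  · rintro ⟨h1, h2, h3⟩
    refine ⟨h1, h2, fun i j => ?_⟩
    have h := h3 i j
    rw [hL, hR] at h
    -- The common factor lies on the circle, hence is non-zero and can be cancelled.
    exact smul_right_injective B (Circle.coe_ne_zero (ζ ^ (s * s - s * D.deg j - s * D.d))) h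
  · rintro ⟨h1, h2, h3⟩
    exact ⟨h1, h2, fun i j => by rw [hL, hR, h3]⟩

/-! ### The isomorphism and its equivariance -/

/-- The isomorphism `u i j ↦ u i j` from `A_o(V, π, ω)` onto the algebra of the shifted datum. -/
noncomputable def shiftEquiv (s : ℤ) : D.Ao ≃⋆ₐ[ℂ] (D.shift s).Ao :=
  StarAlgEquiv.ofStarAlgHom
    (D.lift (D.shift s).u ((D.relations_shift_iff s _).1 (D.shift s).relations_u))
    ((D.shift s).lift D.u ((D.relations_shift_iff s _).2 D.relations_u))
    -- Both composites fix the generators, so by `hom_ext` they are the identities.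
    (D.hom_ext fun i j => by simp)
    ((D.shift s).hom_ext fun i j => by simp)

theorem shiftEquiv_u (s : ℤ) (i j : Fin n) : D.shiftEquiv s (D.u i j) = (D.shift s).u i j :=
  D.lift_u _ ((D.relations_shift_iff s _).1 (D.shift s).relations_u) i j

/-- The weight of $u_{ij}$ is $(d_j-s)-(d_i-s)=d_j-d_i$, the same for both actions. -/
theorem equivariant_shiftEquiv (s : ℤ) : Equivariant D.action (D.shift s).action
    (D.shiftEquiv s : D.Ao →⋆ₐ[ℂ] (D.shift s).Ao) := by
  intro z
  -- For fixed $z$ the claim is an equality of two composite ⋆-homomorphisms, which puts it in the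
  -- form that `hom_ext` reduces to generators.
  refine DFunLike.congr_fun (f := (D.shiftEquiv s : D.Ao →⋆ₐ[ℂ] (D.shift s).Ao).comp
    (D.action.toHom z)) (g := ((D.shift s).action.toHom z).comp
      (D.shiftEquiv s : D.Ao →⋆ₐ[ℂ] (D.shift s).Ao)) (D.hom_ext fun i j => ?_)
  change D.shiftEquiv s (D.action.toHom z (D.u i j)) =
    (D.shift s).action.toHom z (D.shiftEquiv s (D.u i j))
  rw [action_u, map_smul, shiftEquiv_u, action_u, shift_deg, shift_deg, sub_sub_sub_cancel_right]

/-! ### Compatibility with the comultiplications -/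

/-- Two ⋆-homomorphisms given on generators by the formula of the comultiplication are intertwined
by any ⋆-homomorphism that intertwines the legs. -/
theorem intertwine_of_legs {D D' : Datum ζ e} {T T' : Type*} [CStarAlgebra T] [CStarAlgebra T']
    (f : D.Ao →⋆ₐ[ℂ] D'.Ao) (hu : ∀ i j, f (D.u i j) = D'.u i j)
    (j₁ j₂ : D.Ao →⋆ₐ[ℂ] T) (j₁' j₂' : D'.Ao →⋆ₐ[ℂ] T') (g : T →⋆ₐ[ℂ] T')
    (hg₁ : ∀ a, g (j₁ a) = j₁' (f a)) (hg₂ : ∀ a, g (j₂ a) = j₂' (f a))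
    (Δ : D.Ao →⋆ₐ[ℂ] T) (hΔ : ∀ i k, Δ (D.u i k) = ∑ l, j₁ (D.u i l) * j₂ (D.u l k))
    (Δ' : D'.Ao →⋆ₐ[ℂ] T') (hΔ' : ∀ i k, Δ' (D'.u i k) = ∑ l, j₁' (D'.u i l) * j₂' (D'.u l k))
    (a : D.Ao) : Δ' (f a) = g (Δ a) := by
  -- On $u_{ij}$ both sides equal $\sum_l j_1'(u_{il})\,j_2'(u_{lj})$. Only the values on generators
  -- and on the legs enter, so the targets can be arbitrary C⋆-algebras instead of braided tensor
  -- products.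
  have h : Δ'.comp f = g.comp Δ := D.hom_ext fun i j => by
    rw [StarAlgHom.comp_apply, StarAlgHom.comp_apply, hu, hΔ, hΔ', map_sum]
    simp only [map_mul, hg₁, hg₂, hu]
  exact DFunLike.congr_fun h a

/-- An equivariant ⋆-homomorphism that maps generators to generators is compatible with
comultiplications. -/
theorem comul_comp_of_map_u {D D' : Datum ζ e} (f : D.Ao →⋆ₐ[ℂ] D'.Ao)
    (hf : Equivariant D.action D'.action f) (hu : ∀ i j, f (D.u i j) = D'.u i j) (a : D.Ao) :
    D'.comul (f a) = Braided.map ζ f hf f hf (D.comul a) :=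
  intertwine_of_legs f hu (Braided.j₁ ζ D.action D.action) (Braided.j₂ ζ D.action D.action)
    (Braided.j₁ ζ D'.action D'.action) (Braided.j₂ ζ D'.action D'.action)
    (Braided.map ζ f hf f hf) (Braided.map_j₁ ζ f hf f hf) (Braided.map_j₂ ζ f hf f hf)
    D.comul D.comul_u D'.comul D'.comul_u a

end Datum

end BraidedOrth

theorem mainTheorem9 (ζ : Circle) {n : ℕ} {V : Type*} [NormedAddCommGroup V]
    [InnerProductSpace ℂ V] (e : OrthonormalBasis (Fin n) ℂ V)
    (D : BraidedOrth.Datum ζ e) (s : ℤ) :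
    ∃ D' : BraidedOrth.Datum ζ e,
      (∀ (z : Circle) (v : V), D'.rep z v = ((z ^ (-s) : Circle) : ℂ) • D.rep z v) ∧
      (∀ i, D'.deg i = D.deg i - s) ∧
      D'.ω = ∑ i, ∑ j,
        (((ζ ^ (-(s * D.deg j)) : Circle) : ℂ) * D.coeff i j) • TensorProduct.tmul ℂ (e i) (e j) ∧
      D'.d = D.d - 2 * s ∧
      ∃ φ : D.Ao ≃⋆ₐ[ℂ] D'.Ao,
        (∀ i j, φ (D.u i j) = D'.u i j) ∧
        ∃ hφ : BraidedOrth.Equivariant D.action D'.action (φ : D.Ao →⋆ₐ[ℂ] D'.Ao),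
          ∀ a : D.Ao, D'.comul (φ a) =
            BraidedOrth.Braided.map ζ (φ : D.Ao →⋆ₐ[ℂ] D'.Ao) hφ (φ : D.Ao →⋆ₐ[ℂ] D'.Ao) hφ
              (D.comul a) :=
  -- The `rfl` is the formula for $\omega'$: `shift` takes this sum as its vector, up to unfolding
  -- `shiftCoeff`.
  ⟨D.shift s, D.shiftRep_apply s, D.shift_deg s, rfl, D.shift_d s, D.shiftEquiv s,
    D.shiftEquiv_u s, D.equivariant_shiftEquiv s,
    BraidedOrth.Datum.comul_comp_of_map_u _ (D.equivariant_shiftEquiv s) (D.shiftEquiv_u s)⟩
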